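/- Every $x\in[0,1]$ has a non-terminating binary expansion $x=\sum_{n\ge1}x_n2^{-n}$ with $x_n\in\{0,1\}$ (infinitely many $x_n\neq0$ if $x\ne0$; all $x_n=0$ if $x=0$). Put $S_n(x)=x_1+\dots+x_n$, let $T(0.x_1x_2x_3\ldots)=0.x_2x_3x_4\ldots$ be the shift, and define the lower and upper moving digit means $$\underline M(x)=\lim_{n\to\infty}\liminf_{m\to\infty}\frac{S_n(T^mx)}{n},\qquad \overline M(x)=\lim_{n\to\infty}\limsup_{m\to\infty}\frac{S_n(T^mx)}{n}.$$ For $0\le\alpha\le\beta\le1$ let $B(\alpha,\beta)=\{x\in[0,1]:\underline M(x)=\alpha,\ \overline M(x)=\beta\}$ and $B(\alpha)=B(\alpha,\alpha)$. For $0\le\alpha\le1$ let $$h_2(\alpha)=\lim_{\delta\to0^+}\limsup_{n\to\infty}\frac{\log\operatorname{card}\{w\in\{0,1\}^n:\ n(\alpha-\delta)<w_1+\dots+w_n<n(\alpha+\delta)\}}{n\log 2}.$$ **Corollary 1.3 (binary case).** For every $0\le\alpha\le1$ the limit defining $h_2(\alpha)$ exists and, with the convention $0\log0=0$, $$h_2(\alpha)=\frac{-\alpha\log\alpha-(1-\alpha)\log(1-\alpha)}{\log2}.$$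 If $0\le\alpha\le\beta\le1$, then $\dim_HB(\alpha,\beta)=\sup_{\alpha\le t\le\beta}h_2(t)$. If $0\le\alpha\le1$, then $\dim_HB(\alpha)=h_2(\alpha)$. Here $\dim_H$ denotes Hausdorff dimension. -/

import Mathlib

open Filter Topology Set

namespace MovingDigitMean

/-- The `(n+1)`-st digit `x_{n+1}` of the non-terminating `p`-adic expansion
`x = ∑_{n ≥ 1} x_n / p ^ n` of a number `x ∈ [0, 1]`. (The subtraction is truncated, so that all
digits of `0` are `0`.) The theorems `hasSum_digit`, `frequently_digit_ne_zero` and `eq_digit` say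
that this is the unique expansion of `x` which, when `x ≠ 0`, has infinitely many nonzero digits. -/
noncomputable def digit (p : ℕ) (x : ℝ) (n : ℕ) : ℕ :=
  (⌈(p : ℝ) ^ (n + 1) * x⌉₊ - 1) % p

/-- The `n`-th partial sum `S_n(x) = x_1 + ⋯ + x_n` of the digits of `x`. -/
noncomputable def digitSum (p n : ℕ) (x : ℝ) : ℕ :=
  ∑ i ∈ Finset.range n, digit p x i

/-- The shift operator `T (0.x_1x_2x_3…) = 0.x_2x_3x_4…`. -/
noncomputable def shift (p : ℕ) (x : ℝ) : ℝ :=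
  ∑' n : ℕ, (digit p x (n + 1) : ℝ) / (p : ℝ) ^ (n + 1)

/-- The `n`-th lower moving digit mean `liminf_{m → ∞} S_n(T^m x) / n`. -/
noncomputable def lowerMean (p n : ℕ) (x : ℝ) : ℝ :=
  liminf (fun m : ℕ => (digitSum p n ((shift p)^[m] x) : ℝ) / n) atTop

/-- The `n`-th upper moving digit mean `limsup_{m → ∞} S_n(T^m x) / n`. -/
noncomputable def upperMean (p n : ℕ) (x : ℝ) : ℝ :=
  limsup (fun m : ℕ => (digitSum p n ((shift p)^[m] x) : ℝ) / n) atTop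

/-- The level set `B(α, β)`: the `x ∈ [0, 1]` whose lower moving digit mean
`lim_{n → ∞} lowerMean p n x` is `α` and whose upper moving digit mean
`lim_{n → ∞} upperMean p n x` is `β`. -/
def banachSet (p : ℕ) (α β : ℝ) : Set ℝ :=
  {x | x ∈ Icc (0 : ℝ) 1 ∧ Tendsto (fun n : ℕ => lowerMean p n x) atTop (𝓝 α) ∧
    Tendsto (fun n : ℕ => upperMean p n x) atTop (𝓝 β)}

/-- `h(α, n, δ)`: the number of words `w` of length `n` over `{0, …, p - 1}` with
`n (α - δ) < ∑ w_i < n (α + δ)`. -/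
noncomputable def wordCount (p : ℕ) (α : ℝ) (n : ℕ) (δ : ℝ) : ℕ :=
  (Finset.univ.filter fun w : Fin n → Fin p =>
    (n : ℝ) * (α - δ) < ∑ i, ((w i : ℕ) : ℝ) ∧
      ∑ i, ((w i : ℕ) : ℝ) < (n : ℝ) * (α + δ)).card

/-- `v` is the value at `α` of the `p`-adic entropy function:
`lim_{δ → 0+} limsup_{n → ∞} log h(α, n, δ) / ((log p) n) = v`. -/
def IsEntropy (p : ℕ) (α v : ℝ) : Prop :=
  Tendsto (fun δ : ℝ => limsup (fun n : ℕ =>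
    Real.log (wordCount p α n δ) / (Real.log p * n)) atTop) (𝓝[>] 0) (𝓝 v)

/-- The binary entropy function to base `2`, with `0 log 0 = 0` (`Real.log 0 = 0`). -/
noncomputable def h₂ (α : ℝ) : ℝ :=
  (-α * Real.log α - (1 - α) * Real.log (1 - α)) / Real.log 2

/-! Basic facts on the digits: existence and uniqueness of the expansion, action of the shift. -/

theorem digit_lt {p : ℕ} (hp : 2 ≤ p) (x : ℝ) (n : ℕ) : digit p x n < p :=
  Nat.mod_lt _ (by omega)

theorem ceil_bounds {y : ℝ} (hy : 0 < y) :
    ((⌈y⌉₊ - 1 : ℕ) : ℝ) < y ∧ y ≤ ((⌈y⌉₊ - 1 : ℕ) : ℝ) + 1 := by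
  have h1 : 1 ≤ ⌈y⌉₊ := Nat.ceil_pos.mpr hy
  push_cast [Nat.cast_sub h1]
  constructor
  · have := Nat.ceil_lt_add_one hy.le
    linarith
  · have := Nat.le_ceil y
    linarith

theorem ceil_sub_one_eq {y : ℝ} {k : ℕ} (h1 : (k : ℝ) < y) (h2 : y ≤ k + 1) :
    ⌈y⌉₊ - 1 = k := by
  have : ⌈y⌉₊ = k + 1 := by
    rw [Nat.ceil_eq_iff (by omega)]
    push_cast
    exact ⟨by simpa using h1, h2⟩
  omega

theorem sum_digit {p : ℕ} (hp : 2 ≤ p) {x : ℝ} (hx : x ∈ Ioc (0 : ℝ) 1) (n : ℕ) :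
    ∑ i ∈ Finset.range n, (digit p x i : ℝ) / (p : ℝ) ^ (i + 1) =
      ((⌈(p : ℝ) ^ n * x⌉₊ - 1 : ℕ) : ℝ) / (p : ℝ) ^ n := by
  have hp0 : (0 : ℝ) < p := by exact_mod_cast (by omega : 0 < p)
  induction n with
  | zero =>
    have : ⌈x⌉₊ - 1 = 0 := ceil_sub_one_eq (by simpa using hx.1) (by simpa using hx.2)
    simp [this]
  | succ n ih =>
    rw [Finset.sum_range_succ, ih]
    obtain ⟨a1, a2⟩ := ceil_bounds (mul_pos (pow_pos hp0 n) hx.1)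
    obtain ⟨b1, b2⟩ := ceil_bounds (mul_pos (pow_pos hp0 (n + 1)) hx.1)
    unfold digit
    set a := ⌈(p : ℝ) ^ n * x⌉₊ - 1
    set b := ⌈(p : ℝ) ^ (n + 1) * x⌉₊ - 1
    have e : (p : ℝ) ^ (n + 1) * x = p * ((p : ℝ) ^ n * x) := by ring
    rw [e] at b1 b2
    have c1 : p * a < b + 1 := by
      have := (mul_lt_mul_iff_right₀ hp0).2 a1
      exact_mod_cast this.trans_le b2
    have c2 : b < p * (a + 1) := by
      have := (mul_le_mul_iff_right₀ hp0).2 a2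
      exact_mod_cast b1.trans_le this
    have c3 : b / p = a := by
      apply Nat.div_eq_of_lt_le
      · rw [mul_comm]; omega
      · rw [mul_comm]; exact c2
    have c4 : (b : ℝ) = p * a + (b % p : ℕ) := by
      have := Nat.div_add_mod b p
      rw [c3] at this
      exact_mod_cast this.symm
    rw [c4]
    field_simp
    ring

/-- The digits of `x` are the digits of a `p`-adic expansion of `x`. -/
theorem hasSum_digit {p : ℕ} (hp : 2 ≤ p) {x : ℝ} (hx : x ∈ Icc (0 : ℝ) 1) :
    HasSum (fun n : ℕ => (digit p x n : ℝ) / (p : ℝ) ^ (n + 1)) x := by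
  have hp0 : (0 : ℝ) < p := by exact_mod_cast (by omega : 0 < p)
  have hp1 : (1 : ℝ) < p := by exact_mod_cast (by omega : 1 < p)
  rcases hx.1.eq_or_lt with h0 | h0
  · subst h0
    simp [digit, hasSum_zero]
  rw [hasSum_iff_tendsto_nat_of_nonneg (fun i => by positivity)]
  simp_rw [sum_digit hp ⟨h0, hx.2⟩]
  have hl : Tendsto (fun n : ℕ => x - ((p : ℝ)⁻¹) ^ n) atTop (𝓝 x) := by
    simpa using tendsto_const_nhds.sub
      (tendsto_pow_atTop_nhds_zero_of_lt_one (inv_nonneg.2 hp0.le) (inv_lt_one_of_one_lt₀ hp1))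
  refine tendsto_of_tendsto_of_tendsto_of_le_of_le hl tendsto_const_nhds ?_ ?_
  · intro n
    have := (ceil_bounds (mul_pos (pow_pos hp0 n) h0)).2
    have hn := pow_pos hp0 n
    simp only [inv_pow]
    rw [le_div_iff₀ hn, sub_mul, inv_mul_cancel₀ hn.ne']
    linarith
  · intro n
    have := (ceil_bounds (mul_pos (pow_pos hp0 n) h0)).1
    have hn := pow_pos hp0 n
    simp only
    rw [div_le_iff₀ hn]
    linarith

/-- The expansion of a nonzero `x` does not terminate. -/
theorem frequently_digit_ne_zero {p : ℕ} (hp : 2 ≤ p) {x : ℝ} (hx : x ∈ Ioc (0 : ℝ) 1) :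
    ∃ᶠ n in atTop, digit p x n ≠ 0 := by
  have hp0 : (0 : ℝ) < p := by exact_mod_cast (by omega : 0 < p)
  rw [frequently_atTop]
  intro N
  by_contra! hc
  have h := hasSum_digit hp (Ioc_subset_Icc_self hx)
  have h2 : HasSum (fun n : ℕ => (digit p x n : ℝ) / (p : ℝ) ^ (n + 1))
      (∑ n ∈ Finset.range N, (digit p x n : ℝ) / (p : ℝ) ^ (n + 1)) :=
    hasSum_sum_of_ne_finset_zero (fun b hb => by simp [hc b (by simpa using hb)])
  have h3 := h.unique h2
  rw [sum_digit hp hx, eq_div_iff (pow_pos hp0 N).ne'] at h3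
  have := (ceil_bounds (mul_pos (pow_pos hp0 N) hx.1)).1
  linarith

theorem hasSum_geom {p : ℕ} (hp : 2 ≤ p) :
    HasSum (fun n : ℕ => ((p : ℝ) - 1) / (p : ℝ) ^ (n + 1)) 1 := by
  have hp1 : (1 : ℝ) < p := by exact_mod_cast (by omega : 1 < p)
  have hp0 : (0 : ℝ) < p := by linarith
  have h := (hasSum_geometric_of_lt_one (inv_nonneg.2 hp0.le)
    (inv_lt_one_of_one_lt₀ hp1)).mul_left (((p : ℝ) - 1) / p)
  have h0 : (p : ℝ) - 1 ≠ 0 := by linarith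
  have e1 : ((p : ℝ) - 1) / p * (1 - (p : ℝ)⁻¹)⁻¹ = 1 := by
    field_simp
  rw [e1] at h
  have e2 : (fun n : ℕ => ((p : ℝ) - 1) / (p : ℝ) ^ (n + 1)) =
      fun n : ℕ => ((p : ℝ) - 1) / p * (p : ℝ)⁻¹ ^ n := by
    funext n
    rw [inv_pow, pow_succ]
    field_simp
  rw [e2]
  exact h

theorem summable_expansion {p : ℕ} (hp : 2 ≤ p) {d : ℕ → ℕ} (hd : ∀ n, d n < p) :
    Summable (fun n : ℕ => (d n : ℝ) / (p : ℝ) ^ (n + 1)) := by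
  refine Summable.of_nonneg_of_le (fun n => by positivity) (fun n => ?_) (hasSum_geom hp).summable
  have : (d n : ℝ) + 1 ≤ p := by exact_mod_cast hd n
  gcongr
  linarith

theorem expansion_mem {p : ℕ} (hp : 2 ≤ p) {d : ℕ → ℕ} (hd : ∀ n, d n < p) :
    ∑' n : ℕ, (d n : ℝ) / (p : ℝ) ^ (n + 1) ∈ Icc (0 : ℝ) 1 := by
  refine ⟨tsum_nonneg fun n => by positivity, ?_⟩
  rw [← (hasSum_geom hp).tsum_eq]
  refine (summable_expansion hp hd).tsum_le_tsum (fun n => ?_) (hasSum_geom hp).summable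
  have : (d n : ℝ) + 1 ≤ p := by exact_mod_cast hd n
  gcongr
  linarith

theorem expansion_scale {p : ℕ} (hp : 2 ≤ p) {d : ℕ → ℕ} (hd : ∀ n, d n < p) (n : ℕ) :
    (p : ℝ) ^ n * ∑' i : ℕ, (d i : ℝ) / (p : ℝ) ^ (i + 1) =
      ((∑ i ∈ Finset.range n, d i * p ^ (n - 1 - i) : ℕ) : ℝ) +
        ∑' i : ℕ, (d (i + n) : ℝ) / (p : ℝ) ^ (i + 1) := by
  have hp0 : (0 : ℝ) < p := by exact_mod_cast (by omega : 0 < p)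
  rw [← (summable_expansion hp hd).sum_add_tsum_nat_add n, mul_add, ← tsum_mul_left, Finset.mul_sum]
  congr 1
  · push_cast
    refine Finset.sum_congr rfl fun i hi => ?_
    have hi' := Finset.mem_range.1 hi
    have : (p : ℝ) ^ n = p ^ (n - 1 - i) * p ^ (i + 1) := by
      rw [← pow_add]; congr 1; omega
    rw [this]
    field_simp
  · refine tsum_congr fun i => ?_
    rw [show i + n + 1 = n + (i + 1) by ring, pow_add]
    field_simp

/-- Uniqueness of the non-terminating expansion. -/
theorem eq_digit {p : ℕ} (hp : 2 ≤ p) {x : ℝ} {d : ℕ → ℕ} (hd : ∀ n, d n < p)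
    (hs : HasSum (fun n : ℕ => (d n : ℝ) / (p : ℝ) ^ (n + 1)) x)
    (hn : x = 0 ∨ ∃ᶠ n in atTop, d n ≠ 0) (n : ℕ) : d n = digit p x n := by
  have hp0 : (0 : ℝ) < p := by exact_mod_cast (by omega : 0 < p)
  rcases hn with rfl | hn
  · have h0 := (hasSum_zero_iff_of_nonneg (fun i => by positivity)).1 hs
    have := congrFun h0 n
    simp only [Pi.zero_apply, div_eq_zero_iff, (pow_pos hp0 (n + 1)).ne', or_false] at this
    have h1 : d n = 0 := by exact_mod_cast this
    simp [h1, digit]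
  have key := expansion_scale hp hd (n + 1)
  rw [hs.tsum_eq] at key
  have hd' : ∀ i, d (i + (n + 1)) < p := fun i => hd _
  have hm := expansion_mem hp hd'
  have hpos : 0 < ∑' i : ℕ, (d (i + (n + 1)) : ℝ) / (p : ℝ) ^ (i + 1) := by
    obtain ⟨k, hk, hk0⟩ := (frequently_atTop.1 hn) (n + 1)
    refine (summable_expansion hp hd').tsum_pos (fun i => by positivity) (k - (n + 1)) ?_
    rw [Nat.sub_add_cancel hk]
    have : (0 : ℝ) < d k := by exact_mod_cast Nat.pos_of_ne_zero hk0
    positivity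
  have hc := ceil_sub_one_eq (y := (p : ℝ) ^ (n + 1) * x)
    (k := ∑ i ∈ Finset.range (n + 1), d i * p ^ (n + 1 - 1 - i))
    (by rw [key]; linarith) (by rw [key]; linarith [hm.2])
  rw [digit, hc, Finset.sum_range_succ, Nat.add_mod]
  have h0 : (∑ i ∈ Finset.range n, d i * p ^ (n + 1 - 1 - i)) % p = 0 := by
    refine Nat.mod_eq_zero_of_dvd (Finset.dvd_sum fun i hi => ?_)
    have hi' := Finset.mem_range.1 hi
    exact Dvd.dvd.mul_left (dvd_pow_self p (by omega)) _
  rw [h0]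
  simp [Nat.mod_eq_of_lt (hd n)]

theorem shift_mem {p : ℕ} (hp : 2 ≤ p) (x : ℝ) : shift p x ∈ Icc (0 : ℝ) 1 :=
  expansion_mem hp fun n => digit_lt hp x (n + 1)

/-- The shift deletes the first digit. -/
theorem digit_shift {p : ℕ} (hp : 2 ≤ p) {x : ℝ} (hx : x ∈ Icc (0 : ℝ) 1) (n : ℕ) :
    digit p (shift p x) n = digit p x (n + 1) := by
  refine (eq_digit hp (d := fun n => digit p x (n + 1)) (fun n => digit_lt hp x (n + 1))
    (summable_expansion hp fun n => digit_lt hp x (n + 1)).hasSum ?_ n).symm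
  rcases hx.1.eq_or_lt with h0 | h0
  · left
    subst h0
    simp [digit]
  · right
    have := frequently_digit_ne_zero hp ⟨h0, hx.2⟩
    rw [frequently_atTop] at this ⊢
    intro N
    obtain ⟨k, hk, hk0⟩ := this (N + 1)
    exact ⟨k - 1, by omega, by rwa [Nat.sub_add_cancel (by omega)]⟩

/-- `S_n(T^m x) = x_{m+1} + ⋯ + x_{m+n}`. -/
theorem digitSum_shift_iterate {p : ℕ} (hp : 2 ≤ p) {x : ℝ} (hx : x ∈ Icc (0 : ℝ) 1) (n m : ℕ) :
    digitSum p n ((shift p)^[m] x) = ∑ i ∈ Finset.range n, digit p x (m + i) := by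
  induction m generalizing x with
  | zero => simp [digitSum]
  | succ m ih =>
    rw [Function.iterate_succ_apply, ih (shift_mem hp x)]
    refine Finset.sum_congr rfl fun i _ => ?_
    rw [digit_shift hp hx]
    congr 1
    ring

end MovingDigitMean

namespace MovingDigitMean

/-! The function `h₂` is increasing on [0, 1/2], decreasing on [1/2, 1], and equals 1 at 1/2. The
entropy formula is a count of words: binomial coefficients with Stirling-type bounds give many words
of mean near α (`eventually_rpow_le_choose`), and a Bernoulli weight shows that words of mean on the
far side of γ from 1/2 number at most 2 ^ (n h₂ γ) (`card_words_le`, `card_words_ge`).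

Upper bound. Limsup and liminf of window means control the prefix means of the digits
(`eventually_sum_le_of_window`). If β < 1/2, long prefixes of every point of B(α, β) have mean at
most γ, for any γ > β; few words do, and covering by the corresponding cylinders bounds the
dimension by h₂ γ, then by h₂ β as γ → β. The case α > 1/2 is symmetric, and if α ≤ 1/2 ≤ β the
bound is the dimension 1 of the line.

Lower bound. Fix t in [α, β] and cut the digits into blocks of a large length l. Prescribe the sum
of each block so that it follows a profile equal to t, except on sparse ever longer runs where it is
α or β. Bounded discrepancy from the profile puts every such sequence in B(α, β)
(`mem_banachSet_of_discrepancy`). A block outside the runs can be filled in about 2 ^ (l h₂ t) ways,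
enough to encode one base-P digit of a point of [0, 1], with P slightly smaller on the exponential
scale. Since the runs have density zero, the coding map has an r-Hölder inverse for each positive r
< h₂ t (`abs_sub_le_mul_blockDigit`), so its image has dimension at least r
(`le_dimH_image_of_expanding`). -/

theorem h₂_eq_binEntropy (t : ℝ) : h₂ t = Real.binEntropy t / Real.log 2 := by
  rw [h₂, Real.binEntropy, Real.log_inv, Real.log_inv]
  ring

theorem continuous_h₂ : Continuous h₂ := by
  rw [show h₂ = fun t => Real.binEntropy t / Real.log 2 from funext h₂_eq_binEntropy]
  exact Real.binEntropy_continuous.div_const _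

theorem h₂_half : h₂ (1 / 2) = 1 := by
  rw [h₂_eq_binEntropy, one_div, Real.binEntropy_two_inv,
    div_self (Real.log_pos one_lt_two).ne']

theorem h₂_nonneg {t : ℝ} (h0 : 0 ≤ t) (h1 : t ≤ 1) : 0 ≤ h₂ t := by
  rw [h₂_eq_binEntropy]
  exact div_nonneg (Real.binEntropy_nonneg h0 h1) (Real.log_pos one_lt_two).le

/-! ### Binomial coefficients and entropy -/

/-- The term n ^ n / n! of the series of exp n is at most exp n. -/
theorem mul_log_sub_le_log_factorial (n : ℕ) :
    n * Real.log n - n ≤ Real.log n.factorial := by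
  rcases Nat.eq_zero_or_pos n with rfl | hn
  · simp
  have hn' : (0 : ℝ) < n := by exact_mod_cast hn
  have hf : (0 : ℝ) < n.factorial := by exact_mod_cast n.factorial_pos
  have h := Real.log_le_log (by positivity) (Real.pow_div_factorial_le_exp n hn'.le n)
  rw [Real.log_exp, Real.log_div (by positivity) hf.ne', Real.log_pow] at h
  linarith

theorem log_factorial_le (n : ℕ) :
    Real.log n.factorial ≤ n * Real.log n - n + Real.log n + 1 := by
  induction n with
  | zero => simp
  | succ n ih =>
    rcases Nat.eq_zero_or_pos n with rfl | hn
    · simp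
    have hn' : (0 : ℝ) < n := by exact_mod_cast hn
    have hf : (0 : ℝ) < n.factorial := by exact_mod_cast n.factorial_pos
    -- The induction step amounts to (n + 1) (log (n + 1) - log n) ≥ 1.
    have h := Real.one_sub_inv_le_log_of_pos (x := ((n : ℝ) + 1) / n) (by positivity)
    rw [Real.log_div (by positivity) hn'.ne', inv_div] at h
    have h2 : 1 - (n : ℝ) / (n + 1) = 1 / (n + 1) := by field_simp; ring
    rw [h2, div_le_iff₀ (by positivity)] at h
    rw [Nat.factorial_succ]
    push_cast
    rw [Real.log_mul (by positivity) hf.ne']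
    nlinarith

/-- A lower bound for binomial coefficients in terms of the entropy. -/
theorem binEntropy_le_log_choose {n k : ℕ} (hn : 0 < n) (hk : k ≤ n) :
    n * Real.binEntropy (k / n) - 2 * Real.log n - 2 ≤ Real.log (n.choose k) := by
  obtain ⟨l, rfl⟩ := Nat.exists_eq_add_of_le hk
  have hn' : (0 : ℝ) < (k : ℝ) + l := by exact_mod_cast hn
  have hkf : (0 : ℝ) < k.factorial := by exact_mod_cast k.factorial_pos
  have hlf : (0 : ℝ) < l.factorial := by exact_mod_cast l.factorial_pos
  have hc : (0 : ℝ) < (k + l).choose k := by exact_mod_cast Nat.choose_pos hk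
  have h1 : Real.log (k + l).factorial =
      Real.log ((k + l).choose k) + Real.log k.factorial + Real.log l.factorial := by
    have h := Nat.choose_mul_factorial_mul_factorial hk
    rw [Nat.add_sub_cancel_left] at h
    rw [← h]
    push_cast
    rw [Real.log_mul (by positivity) hlf.ne', Real.log_mul hc.ne' hkf.ne']
  have a1 := mul_log_sub_le_log_factorial (k + l)
  have a2 := log_factorial_le k
  have a3 := log_factorial_le l
  have mono : ∀ m : ℕ, (m : ℝ) ≤ k + l → Real.log m ≤ Real.log ((k : ℝ) + l) := fun m hm => by
    rcases Nat.eq_zero_or_pos m with rfl | h0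
    · have : (1 : ℝ) ≤ (k : ℝ) + l := by exact_mod_cast hn
      simpa using Real.log_nonneg this
    · exact Real.log_le_log (by exact_mod_cast h0) hm
  have b1 := mono k (by simp)
  have b2 := mono l (by simp)
  have key : ∀ m : ℕ, (m : ℝ) * Real.log (m / ((k : ℝ) + l)) =
      m * Real.log m - m * Real.log ((k : ℝ) + l) := fun m => by
    rcases Nat.eq_zero_or_pos m with rfl | h0
    · simp
    · rw [Real.log_div (by exact_mod_cast h0.ne') hn'.ne']
      ring
  have e : ((k : ℝ) + l) * Real.binEntropy (k / ((k : ℝ) + l)) =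
      -(k * Real.log (k / ((k : ℝ) + l))) - l * Real.log (l / ((k : ℝ) + l)) := by
    have : 1 - (k : ℝ) / (k + l) = l / (k + l) := by field_simp; ring
    rw [Real.binEntropy, this, Real.log_inv, Real.log_inv]
    field_simp
    ring
  push_cast at *
  rw [e, key, key]
  linarith

/-- Digit densities near `t` yield almost `2 ^ (n h₂ t)` words. -/
theorem eventually_rpow_le_choose {t r : ℝ} (hr : r < h₂ t) :
    ∀ᶠ n : ℕ in atTop, ∀ k ≤ n, |(k : ℝ) - n * t| < 1 → (2 : ℝ) ^ (n * r) ≤ n.choose k := by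
  have hl2 : 0 < Real.log 2 := Real.log_pos one_lt_two
  obtain ⟨r', h1, h2⟩ := exists_between hr
  have hc : ∀ᶠ s in 𝓝 t, r' < h₂ s := continuous_h₂.continuousAt.eventually (lt_mem_nhds h2)
  obtain ⟨δ, hδ, hball⟩ := Metric.eventually_nhds_iff.1 hc
  have hlim : Tendsto (fun n : ℕ => (2 * Real.log n + 2) / n) atTop (𝓝 0) := by
    have e1 : Tendsto (fun n : ℕ => Real.log n / n) atTop (𝓝 0) :=
      (Real.isLittleO_log_id_atTop.tendsto_div_nhds_zero).comp tendsto_natCast_atTop_atTop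
    have e2 : Tendsto (fun n : ℕ => (2 : ℝ) / n) atTop (𝓝 0) :=
      tendsto_const_div_atTop_nhds_zero_nat 2
    have := (e1.const_mul 2).add e2
    simp only [mul_zero, add_zero] at this
    exact this.congr fun n => by ring
  have hsmall := hlim.eventually (gt_mem_nhds (mul_pos (sub_pos.2 h1) hl2))
  have hδ' := (tendsto_const_div_atTop_nhds_zero_nat (1 : ℝ)).eventually (gt_mem_nhds hδ)
  filter_upwards [hsmall, hδ', eventually_gt_atTop 0] with n hn1 hn2 hn0 k hk hkt
  have hn : (0 : ℝ) < n := by exact_mod_cast hn0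
  have hkn : r' < h₂ (k / n) := by
    apply hball
    rw [Real.dist_eq]
    have : (k : ℝ) / n - t = (k - n * t) / n := by field_simp
    rw [this, abs_div, abs_of_pos hn]
    exact (div_lt_div_of_pos_right hkt hn).trans hn2
  rw [h₂_eq_binEntropy, lt_div_iff₀ hl2] at hkn
  have hb := binEntropy_le_log_choose hn0 hk
  rw [div_lt_iff₀ hn] at hn1
  have hcp : (0 : ℝ) < n.choose k := by exact_mod_cast Nat.choose_pos hk
  rw [← Real.log_le_log_iff (by positivity) hcp, Real.log_rpow two_pos]
  nlinarith

theorem choose_le_card_words (n k : ℕ) :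
    n.choose k ≤ (Finset.univ.filter fun w : Fin n → Fin 2 => ∑ i, (w i : ℕ) = k).card := by
  have h : n.choose k = (Finset.powersetCard k (Finset.univ : Finset (Fin n))).card := by simp
  rw [h]
  refine Finset.card_le_card_of_injOn (fun s i => if i ∈ s then 1 else 0) ?_ ?_
  · intro s hs
    have hs' := (Finset.mem_powersetCard.1 (Finset.mem_coe.1 hs)).2
    simp only [Finset.coe_filter, Finset.mem_univ, true_and, mem_ofPred_eq]
    simp [apply_ite, hs']
  · intro s _ s' _ h
    ext i
    have := congrFun h i
    by_cases h1 : i ∈ s <;> by_cases h2 : i ∈ s' <;> simp_all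

/-- The number of words of digit mean at most `γ ≤ 1 / 2`. -/
theorem card_words_le {γ : ℝ} (h0 : 0 < γ) (h1 : γ ≤ 1 / 2) (n : ℕ) :
    ((Finset.univ.filter fun w : Fin n → Fin 2 => ∑ i, ((w i : ℕ) : ℝ) ≤ n * γ).card : ℝ) ≤
      2 ^ (n * h₂ γ) := by
  have hl2 : 0 < Real.log 2 := Real.log_pos one_lt_two
  have h1' : 0 < 1 - γ := by linarith
  set W := Finset.univ.filter fun w : Fin n → Fin 2 => ∑ i, ((w i : ℕ) : ℝ) ≤ n * γ
  -- The Bernoulli weights with probability γ for the digit 1 have total mass 1.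
  have hsum : ∑ w : Fin n → Fin 2, ∏ i, (if w i = 1 then γ else 1 - γ) = 1 := by
    have h := (Finset.prod_univ_sum (fun _ : Fin n => (Finset.univ : Finset (Fin 2)))
      (fun _ b => if b = 1 then γ else 1 - γ)).symm
    rw [Fintype.piFinset_univ] at h
    rw [h]
    simp
  -- As γ ≤ 1 - γ, fewer ones mean a larger weight, so the least weight allowed is the one at mean
  -- γ, namely 2 ^ (-n h₂ γ).
  have hw : ∀ w ∈ W, (2 : ℝ) ^ (-(n * h₂ γ)) ≤ ∏ i, (if w i = 1 then γ else 1 - γ) := by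
    intro w hw
    have hw' : ∑ i, ((w i : ℕ) : ℝ) ≤ n * γ := (Finset.mem_filter.1 hw).2
    have hpos : ∀ i ∈ Finset.univ, 0 < (if w i = 1 then γ else 1 - γ) := fun i _ => by
      split_ifs <;> assumption
    rw [← Real.log_le_log_iff (by positivity) (Finset.prod_pos hpos), Real.log_rpow two_pos,
      Real.log_prod fun i hi => (hpos i hi).ne']
    have e : ∀ i, Real.log (if w i = 1 then γ else 1 - γ) =
        Real.log (1 - γ) - ((w i : ℕ) : ℝ) * (Real.log (1 - γ) - Real.log γ) := fun i => by
      have : w i = 0 ∨ w i = 1 := by omega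
      rcases this with h | h <;> simp [h]
    simp_rw [e]
    rw [Finset.sum_sub_distrib, ← Finset.sum_mul]
    simp only [Finset.sum_const, Finset.card_univ, Fintype.card_fin, nsmul_eq_mul]
    have hlog : 0 ≤ Real.log (1 - γ) - Real.log γ :=
      sub_nonneg.2 (Real.log_le_log h0 (by linarith))
    have := mul_le_mul_of_nonneg_right hw' hlog
    have e2 : n * h₂ γ * Real.log 2 = n * (-γ * Real.log γ - (1 - γ) * Real.log (1 - γ)) := by
      rw [h₂]; field_simp
    rw [neg_mul, e2]
    nlinarith
  have hle : (W.card : ℝ) * 2 ^ (-(n * h₂ γ)) ≤ 1 := by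
    rw [← hsum, ← nsmul_eq_mul]
    refine (Finset.card_nsmul_le_sum W _ _ hw).trans ?_
    refine Finset.sum_le_sum_of_subset_of_nonneg (Finset.subset_univ _) fun w _ _ => ?_
    exact Finset.prod_nonneg fun i _ => by split_ifs <;> linarith
  rw [Real.rpow_neg two_pos.le, ← div_eq_mul_inv, div_le_one (by positivity)] at hle
  exact hle

/-- The number of words of digit mean at least `γ ≥ 1 / 2`. -/
theorem card_words_ge {γ : ℝ} (h0 : 1 / 2 ≤ γ) (h1 : γ < 1) (n : ℕ) :
    ((Finset.univ.filter fun w : Fin n → Fin 2 => n * γ ≤ ∑ i, ((w i : ℕ) : ℝ)).card : ℝ) ≤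
      2 ^ (n * h₂ γ) := by
  have e : h₂ γ = h₂ (1 - γ) := by
    rw [h₂_eq_binEntropy, h₂_eq_binEntropy, Real.binEntropy_one_sub]
  rw [e]
  refine le_trans ?_ (card_words_le (by linarith) (by linarith) n)
  -- Exchanging the digits 0 and 1 reduces to means at most 1 - γ ≤ 1 / 2.
  refine Nat.cast_le.2 (Finset.card_le_card_of_injOn (fun w i => Fin.rev (w i)) ?_ ?_)
  · intro w hw
    simp only [Finset.coe_filter, Finset.mem_univ, true_and, mem_ofPred_eq] at hw ⊢
    have : ∀ i, ((Fin.rev (w i) : ℕ) : ℝ) = 1 - ((w i : ℕ) : ℝ) := fun i => by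
      have : w i = 0 ∨ w i = 1 := by omega
      rcases this with h | h <;> simp [h, Fin.rev]
    rw [Finset.sum_congr rfl fun i _ => this i, Finset.sum_sub_distrib]
    simp only [Finset.sum_const, Finset.card_univ, Fintype.card_fin, nsmul_eq_mul, mul_one]
    linarith
  · intro w _ w' _ h
    funext i
    exact Fin.rev_injective (congrFun h i)

/-! ### The entropy function -/

theorem log_wordCount_div_nonneg (α δ : ℝ) (n : ℕ) :
    0 ≤ Real.log (wordCount 2 α n δ) / (Real.log (2 : ℕ) * n) :=
  div_nonneg (Real.log_natCast_nonneg _) (mul_nonneg (Real.log_natCast_nonneg _) n.cast_nonneg)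

theorem log_card_div_le {m : ℕ} {n : ℕ} {r : ℝ} (hr : 0 ≤ r) (h : (m : ℝ) ≤ 2 ^ (n * r)) :
    Real.log m / (Real.log (2 : ℕ) * n) ≤ r := by
  have hl2 : 0 < Real.log 2 := Real.log_pos one_lt_two
  rcases Nat.eq_zero_or_pos n with rfl | hn
  · simpa using hr
  rcases Nat.eq_zero_or_pos m with rfl | hm
  · simpa using hr
  have hn' : (0 : ℝ) < n := by exact_mod_cast hn
  have := Real.log_le_log (by exact_mod_cast hm) h
  rw [Real.log_rpow two_pos] at this
  rw [Nat.cast_ofNat, div_le_iff₀ (by positivity)]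
  linarith

/-- A bound for `h(α, n, δ)`, uniform in `n`. -/
theorem eventually_wordCount_le {α : ℝ} (h0 : 0 ≤ α) (h1 : α ≤ 1) {r : ℝ} (hr : h₂ α < r) :
    ∀ᶠ δ in 𝓝[>] (0 : ℝ), ∀ n : ℕ, (wordCount 2 α n δ : ℝ) ≤ 2 ^ (n * r) := by
  have hc : ∀ᶠ s in 𝓝 α, h₂ s < r := continuous_h₂.continuousAt.eventually (gt_mem_nhds hr)
  have mono : ∀ (n : ℕ) {s : ℝ}, h₂ s < r → (2 : ℝ) ^ (n * h₂ s) ≤ 2 ^ (n * r) := fun n s hs =>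
    Real.rpow_le_rpow_of_exponent_le one_le_two (by gcongr)
  rcases lt_trichotomy α (1 / 2) with h | h | h
  · have ht : Tendsto (fun δ : ℝ => α + δ) (𝓝[>] 0) (𝓝 α) := by
      have : Tendsto (fun δ : ℝ => α + δ) (𝓝 0) (𝓝 (α + 0)) := tendsto_const_nhds.add tendsto_id
      rw [add_zero] at this
      exact this.mono_left nhdsWithin_le_nhds
    filter_upwards [ht.eventually hc, ht.eventually (gt_mem_nhds h), self_mem_nhdsWithin]
      with δ hδ1 hδ2 hδ0 n
    have hδ0' : 0 < δ := hδ0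
    refine le_trans ?_ ((card_words_le (by linarith) hδ2.le n).trans (mono n hδ1))
    refine Nat.cast_le.2 (Finset.card_le_card (Finset.monotone_filter_right _ fun w _ hw => ?_))
    exact hw.2.le
  -- At α = 1/2 the trivial count 2 ^ n suffices, because h₂ (1/2) = 1.
  · refine Eventually.of_forall fun δ n => ?_
    rw [h, h₂_half] at hr
    have : wordCount 2 α n δ ≤ 2 ^ n := (Finset.card_filter_le _ _).trans (by simp)
    calc (wordCount 2 α n δ : ℝ) ≤ 2 ^ n := by exact_mod_cast this
      _ = 2 ^ (n * (1 : ℝ)) := by simp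
      _ ≤ _ := Real.rpow_le_rpow_of_exponent_le one_le_two (by gcongr)
  · have ht : Tendsto (fun δ : ℝ => α - δ) (𝓝[>] 0) (𝓝 α) := by
      have : Tendsto (fun δ : ℝ => α - δ) (𝓝 0) (𝓝 (α - 0)) := tendsto_const_nhds.sub tendsto_id
      rw [sub_zero] at this
      exact this.mono_left nhdsWithin_le_nhds
    filter_upwards [ht.eventually hc, ht.eventually (lt_mem_nhds h), self_mem_nhdsWithin]
      with δ hδ1 hδ2 hδ0 n
    have hδ0' : 0 < δ := hδ0
    refine le_trans ?_ ((card_words_ge hδ2.le (by linarith) n).trans (mono n hδ1))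
    refine Nat.cast_le.2 (Finset.card_le_card (Finset.monotone_filter_right _ fun w _ hw => ?_))
    exact hw.1.le

/-- Words with exactly ⌊n α⌋ ones have the required mean once 1 / n < δ. -/
theorem eventually_le_wordCount {α : ℝ} (h0 : 0 ≤ α) (h1 : α ≤ 1) {r : ℝ} (hr : r < h₂ α)
    {δ : ℝ} (hδ : 0 < δ) :
    ∀ᶠ n : ℕ in atTop, (2 : ℝ) ^ (n * r) ≤ wordCount 2 α n δ := by
  have hδ' := (tendsto_const_div_atTop_nhds_zero_nat (1 : ℝ)).eventually (gt_mem_nhds hδ)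
  filter_upwards [eventually_rpow_le_choose hr, hδ', eventually_gt_atTop 0] with n hn hn1 hn0
  have hn' : (0 : ℝ) < n := by exact_mod_cast hn0
  have hnα : 0 ≤ n * α := by positivity
  have f1 := Nat.floor_le hnα
  have f2 := Nat.lt_floor_add_one (n * α)
  rw [div_lt_iff₀ hn'] at hn1
  refine (hn ⌊n * α⌋₊ ?_ ?_).trans ?_
  · exact Nat.floor_le_of_le (by nlinarith)
  · rw [abs_lt]; constructor <;> linarith
  · have := choose_le_card_words n ⌊n * α⌋₊
    refine (Nat.cast_le.2 this).trans ?_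
    norm_cast
    refine Finset.card_le_card (Finset.monotone_filter_right _ fun w _ hw => ?_)
    have hw' : ∑ i, ((w i : ℕ) : ℝ) = ⌊n * α⌋₊ := by exact_mod_cast hw
    rw [hw']
    constructor <;> linarith

theorem isEntropy_h₂ {α : ℝ} (h0 : 0 ≤ α) (h1 : α ≤ 1) : IsEntropy 2 α (h₂ α) := by
  have hl2 : 0 < Real.log 2 := Real.log_pos one_lt_two
  have bdd : ∀ δ : ℝ, ∀ n : ℕ,
      Real.log (wordCount 2 α n δ) / (Real.log (2 : ℕ) * n) ≤ 1 := fun δ n => by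
    refine log_card_div_le zero_le_one ?_
    have : wordCount 2 α n δ ≤ 2 ^ n := (Finset.card_filter_le _ _).trans (by simp)
    calc (wordCount 2 α n δ : ℝ) ≤ 2 ^ n := by exact_mod_cast this
      _ = 2 ^ (n * (1 : ℝ)) := by simp
  rw [IsEntropy, tendsto_order]
  constructor
  · intro r hr
    obtain ⟨r', hr1, hr2⟩ := exists_between hr
    filter_upwards [self_mem_nhdsWithin] with δ hδ
    refine hr1.trans_le (le_limsup_of_frequently_le (Eventually.frequently ?_)
      (isBoundedUnder_of ⟨1, bdd δ⟩))
    filter_upwards [eventually_le_wordCount h0 h1 hr2 hδ, eventually_gt_atTop 0] with n hn hn0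
    have hn' : (0 : ℝ) < n := by exact_mod_cast hn0
    have := Real.log_le_log (by positivity) hn
    rw [Real.log_rpow two_pos] at this
    rw [Nat.cast_ofNat, le_div_iff₀ (by positivity)]
    linarith
  · intro r hr
    obtain ⟨r', hr1, hr2⟩ := exists_between hr
    filter_upwards [eventually_wordCount_le h0 h1 hr1] with δ hδ
    refine lt_of_le_of_lt (limsup_le_of_le
      (isCoboundedUnder_le_of_le atTop (log_wordCount_div_nonneg α δ))
      (Eventually.of_forall fun n => ?_)) hr2
    exact log_card_div_le ((h₂_nonneg h0 h1).trans hr1.le) (hδ n)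


/-! ### Upper bound for the dimension -/

/-- After multiplication by p ^ n the integer parts given by the first n digits cancel, and both
remainders lie in [0, 1]. -/
theorem abs_sub_le_of_digit_eq {p : ℕ} (hp : 2 ≤ p) {x y : ℝ} (hx : x ∈ Icc (0 : ℝ) 1)
    (hy : y ∈ Icc (0 : ℝ) 1) {n : ℕ} (h : ∀ i < n, digit p x i = digit p y i) :
    |x - y| ≤ ((p : ℝ) ^ n)⁻¹ := by
  have hp0 : (0 : ℝ) < p := by exact_mod_cast (by omega : 0 < p)
  have kx := expansion_scale hp (digit_lt hp x) n
  have ky := expansion_scale hp (digit_lt hp y) n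
  rw [(hasSum_digit hp hx).tsum_eq] at kx
  rw [(hasSum_digit hp hy).tsum_eq] at ky
  have mx := expansion_mem hp fun i => digit_lt hp x (i + n)
  have my := expansion_mem hp fun i => digit_lt hp y (i + n)
  have e : ∑ i ∈ Finset.range n, digit p x i * p ^ (n - 1 - i) =
      ∑ i ∈ Finset.range n, digit p y i * p ^ (n - 1 - i) :=
    Finset.sum_congr rfl fun i hi => by rw [h i (Finset.mem_range.1 hi)]
  rw [e] at kx
  rw [← one_div, le_div_iff₀ (pow_pos hp0 n), ← abs_of_pos (pow_pos hp0 n), ← abs_mul, abs_le]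
  constructor <;> linarith [mx.1, mx.2, my.1, my.2]

/-- A set whose digit words of length `n` are eventually among `2 ^ (n s)` words has dimension at
most `s`. -/
theorem dimH_le_of_card_words_le {E : Set ℝ} (hE : E ⊆ Icc 0 1) {s : ℝ} (hs : 0 ≤ s)
    (W : ∀ n, Finset (Fin n → Fin 2)) (hW : ∀ n, ((W n).card : ℝ) ≤ 2 ^ (n * s))
    (h : ∀ᶠ n in atTop, ∀ x ∈ E,
      (fun i : Fin n => (⟨digit 2 x i, digit_lt le_rfl x i⟩ : Fin 2)) ∈ W n) :
    dimH E ≤ ENNReal.ofReal s := by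
  rw [ENNReal.ofReal]
  refine dimH_le_of_hausdorffMeasure_ne_top (ne_of_lt (lt_of_le_of_lt ?_ ENNReal.one_lt_top))
  have hr : Tendsto (fun n : ℕ => ENNReal.ofReal (((2 : ℝ) ^ n)⁻¹)) atTop (𝓝 0) := by
    rw [← ENNReal.ofReal_zero]
    refine ENNReal.tendsto_ofReal ?_
    simpa using tendsto_pow_atTop_nhds_zero_of_lt_one (by norm_num : (0 : ℝ) ≤ 1 / 2) (by norm_num)
  have hdiam : ∀ (n : ℕ) (w : Fin n → Fin 2),
      Metric.ediam {x ∈ Icc (0 : ℝ) 1 | ∀ i : Fin n, digit 2 x i = w i} ≤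
        ENNReal.ofReal (((2 : ℝ) ^ n)⁻¹) := fun n w => by
    refine Metric.ediam_le fun x hx y hy => ?_
    rw [edist_dist, Real.dist_eq]
    refine ENNReal.ofReal_le_ofReal ?_
    have := abs_sub_le_of_digit_eq le_rfl hx.1 hy.1 (n := n) fun i hi => by
      rw [hx.2 ⟨i, hi⟩, hy.2 ⟨i, hi⟩]
    exact_mod_cast this
  -- The cylinders of the words in W n cover E, and their diameters to the power s sum to at most 2
  -- ^ (n s) · 2 ^ (-n s) = 1.
  refine (MeasureTheory.Measure.hausdorffMeasure_le_liminf_sum _ E _ hr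
    (fun n (w : W n) => {x ∈ Icc (0 : ℝ) 1 | ∀ i : Fin n, digit 2 x i = w.1 i})
    (Eventually.of_forall fun n w => hdiam n w.1) ?_).trans ?_
  · filter_upwards [h] with n hn x hx
    exact mem_iUnion.2 ⟨⟨_, hn x hx⟩, hE hx, fun i => rfl⟩
  · refine liminf_le_of_le (by isBoundedDefault) fun b hb => ?_
    obtain ⟨n, hn⟩ := hb.exists
    refine hn.trans ?_
    rw [Real.coe_toNNReal s hs]
    calc ∑ w : W n, Metric.ediam {x ∈ Icc (0 : ℝ) 1 | ∀ i : Fin n, digit 2 x i = w.1 i} ^ s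
        ≤ ∑ w : W n, ENNReal.ofReal (((2 : ℝ) ^ n)⁻¹) ^ s :=
          Finset.sum_le_sum fun w _ => ENNReal.rpow_le_rpow (hdiam n w.1) hs
      _ = ENNReal.ofReal ((W n).card * (((2 : ℝ) ^ n)⁻¹) ^ s) := by
          rw [ENNReal.ofReal_rpow_of_nonneg (by positivity) hs]
          simp [ENNReal.ofReal_mul]
      _ ≤ 1 := by
          rw [ENNReal.ofReal_le_one, Real.inv_rpow (by positivity), ← Real.rpow_natCast,
            ← Real.rpow_mul two_pos.le, ← div_eq_mul_inv, div_le_one (by positivity)]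
          exact hW n

/-! ### From window means to prefix means -/

/-- Beyond m the prefix is tiled by windows of length n; the start and the incomplete window cost at
most m + n, which N (γ' - γ) eventually absorbs. -/
theorem eventually_sum_le_of_window {f : ℕ → ℝ} (hf : ∀ i, f i ≤ 1) {n : ℕ} (hn : 0 < n)
    {γ γ' : ℝ} (h0 : 0 ≤ γ) (hγ : γ < γ')
    (h : ∀ᶠ m in atTop, ∑ i ∈ Finset.range n, f (m + i) ≤ n * γ) :
    ∀ᶠ N : ℕ in atTop, ∑ i ∈ Finset.range N, f i ≤ N * γ' := by
  obtain ⟨m, hm⟩ := eventually_atTop.1 h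
  have triv : ∀ N, ∑ i ∈ Finset.range N, f i ≤ N := fun N => by
    simpa using Finset.sum_le_card_nsmul (Finset.range N) f 1 fun i _ => hf i
  have key : ∀ N, ∑ i ∈ Finset.range (m + N), f i ≤ m + n + N * γ := by
    intro N
    induction N using Nat.strong_induction_on with
    | _ N ih =>
      rcases lt_or_ge N n with hN | hN
      · have h1 := triv (m + N)
        have h2 : (N : ℝ) ≤ n := by exact_mod_cast hN.le
        have : 0 ≤ N * γ := by positivity
        push_cast at h1
        linarith
      · obtain ⟨k, rfl⟩ := Nat.exists_eq_add_of_le' hN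
        have h1 := ih k (by omega)
        have h2 := hm (m + k) (by omega)
        rw [← add_assoc, Finset.sum_range_add]
        push_cast
        linarith
  have hlim : Tendsto (fun N : ℕ => (N : ℝ) * (γ' - γ)) atTop atTop :=
    tendsto_natCast_atTop_atTop.atTop_mul_const (sub_pos.2 hγ)
  filter_upwards [hlim.eventually_ge_atTop ((m : ℝ) + n), eventually_ge_atTop m] with N hN hmN
  obtain ⟨k, rfl⟩ := Nat.exists_eq_add_of_le hmN
  have := key k
  push_cast at *
  have : 0 ≤ m * γ := by positivity
  linarith

theorem window_mean_mem (n m : ℕ) (x : ℝ) :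
    (digitSum 2 n ((shift 2)^[m] x) : ℝ) / n ∈ Icc (0 : ℝ) 1 := by
  refine ⟨by positivity, div_le_one_of_le₀ ?_ n.cast_nonneg⟩
  have : digitSum 2 n ((shift 2)^[m] x) ≤ n := by
    simpa [digitSum] using Finset.sum_le_card_nsmul (Finset.range n)
      (digit 2 ((shift 2)^[m] x)) 1 fun i _ => Nat.le_of_lt_succ (digit_lt le_rfl _ i)
  exact_mod_cast this

theorem isBoundedUnder_window_le (n : ℕ) (x : ℝ) : IsBoundedUnder (· ≤ ·) atTop
    fun m : ℕ => (digitSum 2 n ((shift 2)^[m] x) : ℝ) / n :=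
  isBoundedUnder_of ⟨1, fun m => (window_mean_mem n m x).2⟩

theorem isBoundedUnder_window_ge (n : ℕ) (x : ℝ) : IsBoundedUnder (· ≥ ·) atTop
    fun m : ℕ => (digitSum 2 n ((shift 2)^[m] x) : ℝ) / n :=
  isBoundedUnder_of ⟨0, fun m => (window_mean_mem n m x).1⟩

theorem eventually_sum_digit_le {α β γ x : ℝ} (hβ : 0 ≤ β) (hγ : β < γ)
    (hx : x ∈ banachSet 2 α β) :
    ∀ᶠ N : ℕ in atTop, ∑ i ∈ Finset.range N, (digit 2 x i : ℝ) ≤ N * γ := by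
  obtain ⟨δ, h1, h2⟩ := exists_between hγ
  obtain ⟨n, hn, hn0⟩ :=
    ((hx.2.2.eventually (gt_mem_nhds h1)).and (eventually_gt_atTop 0)).exists
  have hn' : (0 : ℝ) < n := by exact_mod_cast hn0
  refine eventually_sum_le_of_window (fun i => ?_) hn0 (hβ.trans h1.le) h2 ?_
  · exact_mod_cast Nat.le_of_lt_succ (digit_lt le_rfl x i)
  · filter_upwards [eventually_lt_of_limsup_lt hn (isBoundedUnder_window_le n x)] with m hm
    rw [digitSum_shift_iterate le_rfl hx.1, div_lt_iff₀ hn'] at hm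
    push_cast at hm
    linarith

theorem eventually_le_sum_digit {α β γ x : ℝ} (hα : α ≤ 1) (hγ : γ < α)
    (hx : x ∈ banachSet 2 α β) :
    ∀ᶠ N : ℕ in atTop, N * γ ≤ ∑ i ∈ Finset.range N, (digit 2 x i : ℝ) := by
  obtain ⟨δ, h1, h2⟩ := exists_between hγ
  obtain ⟨n, hn, hn0⟩ :=
    ((hx.2.1.eventually (lt_mem_nhds h2)).and (eventually_gt_atTop 0)).exists
  have hn' : (0 : ℝ) < n := by exact_mod_cast hn0
  -- The lower bound is the upper bound for the complementary digits.
  have key := eventually_sum_le_of_window (f := fun i => 1 - (digit 2 x i : ℝ)) (γ := 1 - δ)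
    (γ' := 1 - γ) (fun i => by simp) hn0 (by linarith) (by linarith) ?_
  · filter_upwards [key] with N hN
    rw [Finset.sum_sub_distrib] at hN
    simp only [Finset.sum_const, Finset.card_range, nsmul_eq_mul, mul_one] at hN
    linarith
  · filter_upwards [eventually_lt_of_lt_liminf hn (isBoundedUnder_window_ge n x)] with m hm
    rw [digitSum_shift_iterate le_rfl hx.1, lt_div_iff₀ hn'] at hm
    rw [Finset.sum_sub_distrib]
    simp only [Finset.sum_const, Finset.card_range, nsmul_eq_mul, mul_one]
    push_cast at hm
    linarith

/-- Countable stability of the dimension makes the threshold uniform: E is the union over N of the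
points whose words are admissible from N on. -/
theorem dimH_le_of_eventually_card_le {E : Set ℝ} (hE : E ⊆ Icc 0 1) {s : ℝ} (hs : 0 ≤ s)
    (W : ∀ n, Finset (Fin n → Fin 2)) (hW : ∀ n, ((W n).card : ℝ) ≤ 2 ^ (n * s))
    (h : ∀ x ∈ E, ∀ᶠ n in atTop,
      (fun i : Fin n => (⟨digit 2 x i, digit_lt le_rfl x i⟩ : Fin 2)) ∈ W n) :
    dimH E ≤ ENNReal.ofReal s := by
  have hsub : E ⊆ ⋃ N : ℕ, {x ∈ E | ∀ n ≥ N,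
      (fun i : Fin n => (⟨digit 2 x i, digit_lt le_rfl x i⟩ : Fin 2)) ∈ W n} := fun x hx => by
    obtain ⟨N, hN⟩ := eventually_atTop.1 (h x hx)
    exact mem_iUnion.2 ⟨N, hx, hN⟩
  refine (dimH_mono hsub).trans ?_
  rw [dimH_iUnion]
  refine iSup_le fun N => dimH_le_of_card_words_le (fun x hx => hE hx.1) hs W hW ?_
  filter_upwards [eventually_ge_atTop N] with n hn x hx
  exact hx.2 n hn

theorem dimH_banachSet_le_right {α β : ℝ} (h0 : 0 ≤ β) (h1 : β < 1 / 2) :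
    dimH (banachSet 2 α β) ≤ ENNReal.ofReal (h₂ β) := by
  have hlim : Tendsto (fun γ => ENNReal.ofReal (h₂ γ)) (𝓝[>] β) (𝓝 (ENNReal.ofReal (h₂ β))) :=
    (ENNReal.continuous_ofReal.comp continuous_h₂).continuousAt.tendsto.mono_left
      nhdsWithin_le_nhds
  refine ge_of_tendsto hlim ?_
  filter_upwards [self_mem_nhdsWithin, nhdsWithin_le_nhds (gt_mem_nhds h1)] with γ hγ hγ1
  have hγ0 : 0 < γ := h0.trans_lt hγ
  refine dimH_le_of_eventually_card_le (fun x hx => hx.1) (h₂_nonneg hγ0.le (by linarith)) _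
    (card_words_le hγ0 hγ1.le) fun x hx => ?_
  filter_upwards [eventually_sum_digit_le h0 hγ hx] with n hn
  rw [Finset.sum_range] at hn
  simpa using hn

theorem dimH_banachSet_le_left {α β : ℝ} (h0 : 1 / 2 < α) (h1 : α ≤ 1) :
    dimH (banachSet 2 α β) ≤ ENNReal.ofReal (h₂ α) := by
  have hlim : Tendsto (fun γ => ENNReal.ofReal (h₂ γ)) (𝓝[<] α) (𝓝 (ENNReal.ofReal (h₂ α))) :=
    (ENNReal.continuous_ofReal.comp continuous_h₂).continuousAt.tendsto.mono_left
      nhdsWithin_le_nhds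
  refine ge_of_tendsto hlim ?_
  filter_upwards [self_mem_nhdsWithin, nhdsWithin_le_nhds (lt_mem_nhds h0)] with γ hγ hγ0
  have hγ1 : γ < 1 := lt_of_lt_of_le hγ h1
  refine dimH_le_of_eventually_card_le (fun x hx => hx.1) (h₂_nonneg (by linarith) hγ1.le) _
    (card_words_ge hγ0.le hγ1) fun x hx => ?_
  filter_upwards [eventually_le_sum_digit h1 hγ hx] with n hn
  rw [Finset.sum_range] at hn
  simpa using hn

theorem dimH_banachSet_le {α β : ℝ} (h0 : 0 ≤ α) (hαβ : α ≤ β) (h1 : β ≤ 1) :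
    dimH (banachSet 2 α β) ≤ ⨆ t ∈ Icc α β, ENNReal.ofReal (h₂ t) := by
  rcases lt_or_ge β (1 / 2) with hβ | hβ
  · exact (dimH_banachSet_le_right (h0.trans hαβ) hβ).trans
      (le_iSup₂_of_le β (right_mem_Icc.2 hαβ) le_rfl)
  rcases lt_or_ge (1 / 2) α with hα | hα
  · exact (dimH_banachSet_le_left hα (hαβ.trans h1)).trans
      (le_iSup₂_of_le α (left_mem_Icc.2 hαβ) le_rfl)
  · refine le_iSup₂_of_le (1 / 2) ⟨hα, hβ⟩ ?_
    rw [h₂_half, ENNReal.ofReal_one, ← Real.dimH_univ]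
    exact dimH_mono (subset_univ _)


/-! ### Tools for the lower bound of the dimension -/

/-- An expanding map of the unit interval has an image of large dimension. -/
theorem le_dimH_image_of_expanding {g : ℝ → ℝ} {C r : ℝ} (hr : 0 < r)
    (h : ∀ x ∈ Icc (0 : ℝ) 1, ∀ y ∈ Icc (0 : ℝ) 1, |x - y| ≤ C * |g x - g y| ^ r) :
    ENNReal.ofReal r ≤ dimH (g '' Icc 0 1) := by
  have hinj : InjOn g (Icc 0 1) := fun x hx y hy hxy => by
    have := h x hx y hy
    rw [hxy, sub_self, abs_zero, Real.zero_rpow hr.ne', mul_zero] at this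
    exact sub_eq_zero.1 (abs_nonpos_iff.1 this)
  have hleft := hinj.leftInvOn_invFunOn
  set f := Function.invFunOn g (Icc (0 : ℝ) 1)
  have hf : HolderOnWith C.toNNReal r.toNNReal f (g '' Icc 0 1) := by
    rintro _ ⟨x, hx, rfl⟩ _ ⟨y, hy, rfl⟩
    rw [hleft hx, hleft hy, edist_dist, edist_dist, Real.dist_eq, Real.dist_eq,
      Real.coe_toNNReal r hr.le, ENNReal.ofReal_rpow_of_nonneg (abs_nonneg _) hr.le,
      ENNReal.ofNNReal_toNNReal, ← ENNReal.ofReal_mul' (by positivity)]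
    exact ENNReal.ofReal_le_ofReal (h x hx y hy)
  -- The r-Hölder inverse maps the image back onto [0, 1], so 1 ≤ dim (image) / r.
  have hdim := hf.dimH_image_le (Real.toNNReal_pos.2 hr)
  rw [hleft.image_image, Real.dimH_of_nonempty_interior (by simp), Module.finrank_self,
    Nat.cast_one, ENNReal.le_div_iff_mul_le (by simp [hr]) (by simp), one_mul] at hdim
  exact hdim

theorem abs_window_sum_sub_le {d : ℕ → ℕ} {τ : ℕ → ℝ} {C : ℝ}
    (hC : ∀ N, |∑ i ∈ Finset.range N, (d i : ℝ) - ∑ i ∈ Finset.range N, τ i| ≤ C) (n m : ℕ) :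
    |∑ i ∈ Finset.range n, (d (m + i) : ℝ) - ∑ i ∈ Finset.range n, τ (m + i)| ≤ 2 * C := by
  have h1 := abs_le.1 (hC m)
  have h2 := abs_le.1 (hC (m + n))
  rw [Finset.sum_range_add, Finset.sum_range_add] at h2
  rw [abs_le]
  constructor <;> linarith [h1.1, h1.2, h2.1, h2.2]

/-- A number belongs to `B(α, β)` if its digits follow a profile with values in `[α, β]` which has
arbitrarily long runs of `α` and of `β` arbitrarily far out. -/
theorem mem_banachSet_of_discrepancy {x α β C : ℝ} (hx : x ∈ Icc (0 : ℝ) 1) {τ : ℕ → ℝ}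
    (hτ : ∀ i, τ i ∈ Icc α β)
    (hC : ∀ N, |∑ i ∈ Finset.range N, (digit 2 x i : ℝ) - ∑ i ∈ Finset.range N, τ i| ≤ C)
    (hα : ∀ n, ∃ᶠ m in atTop, ∀ i < n, τ (m + i) = α)
    (hβ : ∀ n, ∃ᶠ m in atTop, ∀ i < n, τ (m + i) = β) : x ∈ banachSet 2 α β := by
  have herr : Tendsto (fun n : ℕ => 2 * C / n) atTop (𝓝 0) :=
      tendsto_const_div_atTop_nhds_zero_nat _
  -- A window sum is a difference of two prefix sums, so the discrepancy at most doubles, and it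
  -- vanishes after division by n.
  have hmean : ∀ n m : ℕ, 0 < n →
      |(digitSum 2 n ((shift 2)^[m] x) : ℝ) / n - (∑ i ∈ Finset.range n, τ (m + i)) / n| ≤
        2 * C / n := fun n m hn => by
    have hn' : (0 : ℝ) < n := by exact_mod_cast hn
    rw [digitSum_shift_iterate le_rfl hx, ← sub_div, abs_div, abs_of_pos hn']
    push_cast
    exact div_le_div_of_nonneg_right (abs_window_sum_sub_le hC n m) hn'.le
  have hlow : ∀ n m : ℕ, 0 < n → α ≤ (∑ i ∈ Finset.range n, τ (m + i)) / n := fun n m hn => by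
    rw [le_div_iff₀ (by exact_mod_cast hn)]
    simpa [mul_comm] using
      Finset.card_nsmul_le_sum (Finset.range n) _ α fun i _ => (hτ (m + i)).1
  have hup : ∀ n m : ℕ, 0 < n → (∑ i ∈ Finset.range n, τ (m + i)) / n ≤ β := fun n m hn => by
    rw [div_le_iff₀ (by exact_mod_cast hn)]
    simpa [mul_comm] using
      Finset.sum_le_card_nsmul (Finset.range n) _ β fun i _ => (hτ (m + i)).2
  have hconst : ∀ (n m : ℕ) (c : ℝ), 0 < n → (∀ i < n, τ (m + i) = c) →
      (∑ i ∈ Finset.range n, τ (m + i)) / n = c := fun n m c hn h => by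
    have hn' : (n : ℝ) ≠ 0 := by exact_mod_cast hn.ne'
    rw [Finset.sum_congr rfl fun i hi => h i (Finset.mem_range.1 hi)]
    simp [hn']
  refine ⟨hx, ?_, ?_⟩
  · have h1 : Tendsto (fun n : ℕ => α - 2 * C / n) atTop (𝓝 α) := by
      simpa using tendsto_const_nhds.sub herr
    have h2 : Tendsto (fun n : ℕ => α + 2 * C / n) atTop (𝓝 α) := by
      simpa using tendsto_const_nhds.add herr
    refine tendsto_of_tendsto_of_tendsto_of_le_of_le' h1 h2 ?_ ?_
    · filter_upwards [eventually_gt_atTop 0] with n hn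
      refine le_liminf_of_le (isBoundedUnder_window_le n x).isCoboundedUnder_ge
        (Eventually.of_forall fun m => ?_)
      linarith [(abs_le.1 (hmean n m hn)).1, hlow n m hn]
    · filter_upwards [eventually_gt_atTop 0] with n hn
      refine liminf_le_of_frequently_le ((hα n).mono fun m hm => ?_) (isBoundedUnder_window_ge n x)
      linarith [(abs_le.1 (hmean n m hn)).2, hconst n m α hn hm]
  · have h1 : Tendsto (fun n : ℕ => β - 2 * C / n) atTop (𝓝 β) := by
      simpa using tendsto_const_nhds.sub herr
    have h2 : Tendsto (fun n : ℕ => β + 2 * C / n) atTop (𝓝 β) := by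
      simpa using tendsto_const_nhds.add herr
    refine tendsto_of_tendsto_of_tendsto_of_le_of_le' h1 h2 ?_ ?_
    · filter_upwards [eventually_gt_atTop 0] with n hn
      refine le_limsup_of_frequently_le ((hβ n).mono fun m hm => ?_) (isBoundedUnder_window_le n x)
      linarith [(abs_le.1 (hmean n m hn)).1, hconst n m β hn hm]
    · filter_upwards [eventually_gt_atTop 0] with n hn
      refine limsup_le_of_le (isBoundedUnder_window_ge n x).isCoboundedUnder_le
        (Eventually.of_forall fun m => ?_)
      linarith [(abs_le.1 (hmean n m hn)).2, hup n m hn]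

/-! ### Separation of distinct expansions -/

/-- The gain at n could be eaten up entirely only if every later difference e i - d i were -1. At q
it is not, which saves the place value 2 ^ (-(q + 1)). -/
theorem le_sub_of_digit_lt {d e : ℕ → ℕ} (hd : ∀ i, d i < 2) (he : ∀ i, e i < 2) {n q : ℕ}
    (hlt : ∀ i < n, d i = e i) (hn : d n < e n) (hnq : n < q) (hq : d q ≤ e q) :
    ((2 : ℝ) ^ (q + 1))⁻¹ ≤
      ∑' i, (e i : ℝ) / (2 : ℝ) ^ (i + 1) - ∑' i, (d i : ℝ) / (2 : ℝ) ^ (i + 1) := by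
  have sd : Summable fun i => (d i : ℝ) / (2 : ℝ) ^ (i + 1) := by
    exact_mod_cast summable_expansion le_rfl hd
  have se : Summable fun i => (e i : ℝ) / (2 : ℝ) ^ (i + 1) := by
    exact_mod_cast summable_expansion le_rfl he
  rw [← se.tsum_sub sd]
  have hlim := (se.sub sd).hasSum.tendsto_sum_nat
  set f : ℕ → ℝ := fun i => (e i : ℝ) / (2 : ℝ) ^ (i + 1) - (d i : ℝ) / (2 : ℝ) ^ (i + 1) with hf
  have hpow : ∀ k : ℕ, ((2 : ℝ) ^ k)⁻¹ = ((2 : ℝ) ^ (k + 1))⁻¹ + ((2 : ℝ) ^ (k + 1))⁻¹ :=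
    fun k => by
    rw [pow_succ, mul_inv]; ring
  have hlow : ∀ k, -((2 : ℝ) ^ (k + 1))⁻¹ ≤ f k := fun k => by
    have h1 : (d k : ℝ) ≤ 1 := by exact_mod_cast Nat.le_of_lt_succ (hd k)
    have h2 : (0 : ℝ) ≤ e k := by positivity
    rw [hf]
    simp only
    rw [← sub_div, ← neg_one_mul, ← div_eq_mul_inv]
    gcongr
    linarith
  have hnpos : ((2 : ℝ) ^ (n + 1))⁻¹ ≤ f n := by
    have h1 : (d n : ℝ) + 1 ≤ e n := by exact_mod_cast hn
    rw [hf]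
    simp only
    rw [← sub_div, ← one_div]
    gcongr
    linarith
  have hqpos : 0 ≤ f q := by
    have h1 : (d q : ℝ) ≤ e q := by exact_mod_cast hq
    rw [hf]
    simp only
    rw [← sub_div]
    exact div_nonneg (by linarith) (by positivity)
  have hzero : ∑ i ∈ Finset.range n, f i = 0 :=
    Finset.sum_eq_zero fun i hi => by simp [hf, hlt i (Finset.mem_range.1 hi)]
  have step1 : ∀ k, n + 1 + k ≤ q →
      ((2 : ℝ) ^ (n + 1 + k))⁻¹ ≤ ∑ i ∈ Finset.range (n + 1 + k), f i := by
    intro k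
    induction k with
    | zero =>
      intro _
      rw [add_zero, Finset.sum_range_succ, hzero, zero_add]
      exact hnpos
    | succ k ih =>
      intro hk
      rw [← add_assoc, Finset.sum_range_succ]
      linarith [ih (by omega), hlow (n + 1 + k), hpow (n + 1 + k)]
  have step2 : ∀ k, ((2 : ℝ) ^ (q + 1))⁻¹ + ((2 : ℝ) ^ (q + 1 + k))⁻¹ ≤
      ∑ i ∈ Finset.range (q + 1 + k), f i := by
    intro k
    induction k with
    | zero =>
      have h := step1 (q - (n + 1)) (by omega)
      rw [show n + 1 + (q - (n + 1)) = q by omega] at h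
      rw [add_zero, Finset.sum_range_succ]
      linarith [hpow q]
    | succ k ih =>
      rw [← add_assoc, Finset.sum_range_succ]
      linarith [hlow (q + 1 + k), hpow (q + 1 + k)]
  refine ge_of_tendsto hlim ?_
  filter_upwards [eventually_ge_atTop (q + 1)] with N hN
  obtain ⟨k, rfl⟩ := Nat.exists_eq_add_of_le hN
  have : 0 ≤ ((2 : ℝ) ^ (q + 1 + k))⁻¹ := by positivity
  linarith [step2 k]

/-- Two expansions which differ before position `a`, and have equal digit sums over the window of
length `l` at `a`, define numbers at distance at least `2 ^ (-(a + l))`. -/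
theorem le_abs_sub_of_window_eq {d e : ℕ → ℕ} (hd : ∀ i, d i < 2) (he : ∀ i, e i < 2) {n a l : ℕ}
    (hne : d n ≠ e n) (hna : n < a) (hl : 0 < l)
    (hsum : ∑ i ∈ Finset.range l, d (a + i) = ∑ i ∈ Finset.range l, e (a + i)) :
    ((2 : ℝ) ^ (a + l))⁻¹ ≤
      |∑' i, (d i : ℝ) / (2 : ℝ) ^ (i + 1) - ∑' i, (e i : ℝ) / (2 : ℝ) ^ (i + 1)| := by
  have main : ∀ {d e : ℕ → ℕ}, (∀ i, d i < 2) → (∀ i, e i < 2) → ∀ {n : ℕ},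
      (∀ i < n, d i = e i) → d n < e n → n < a →
      ∑ i ∈ Finset.range l, d (a + i) = ∑ i ∈ Finset.range l, e (a + i) →
      ((2 : ℝ) ^ (a + l))⁻¹ ≤
        |∑' i, (e i : ℝ) / (2 : ℝ) ^ (i + 1) - ∑' i, (d i : ℝ) / (2 : ℝ) ^ (i + 1)| := by
    intro d e hd he n hlt hn hna hsum
    -- Equal sums prevent the digits of d from exceeding those of e throughout the window.
    obtain ⟨i, hi, hle⟩ := Finset.exists_le_of_sum_le (Finset.nonempty_range_iff.2 hl.ne') hsum.le
    have hil := Finset.mem_range.1 hi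
    refine le_trans ?_ ((le_sub_of_digit_lt hd he hlt hn (q := a + i) (by omega) hle).trans
      (le_abs_self _))
    exact inv_anti₀ (by positivity) (pow_le_pow_right₀ one_le_two (by omega))
  classical
  have hex : ∃ n, d n ≠ e n := ⟨n, hne⟩
  have hlt : ∀ i < Nat.find hex, d i = e i := fun i hi => not_not.1 (Nat.find_min hex hi)
  have hna' : Nat.find hex < a := (Nat.find_min' hex hne).trans_lt hna
  rcases lt_or_gt_of_ne (Nat.find_spec hex) with h | h
  · rw [abs_sub_comm]
    exact main hd he hlt h hna' hsum
  · exact main he hd (fun i hi => (hlt i hi).symm) h hna' hsum.symm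


/-! ### The profile with sparse runs -/

/-- The indices in the sparse runs `[2 ^ i, 2 ^ i + i)`. -/
abbrev IsRun (j : ℕ) : Prop := j - 2 ^ Nat.log 2 j < Nat.log 2 j

/-- The sequence with value `t` outside of the runs `[2 ^ i, 2 ^ i + i)`, and with value `α` or `β`
on such a run, depending on the parity of `i`. -/
noncomputable def profile (α t β : ℝ) (j : ℕ) : ℝ :=
  if IsRun j then (if Even (Nat.log 2 j) then α else β) else t

theorem profile_mem {α t β : ℝ} (h1 : α ≤ t) (h2 : t ≤ β) (j : ℕ) : profile α t β j ∈ Icc α β := by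
  unfold profile
  split_ifs
  exacts [⟨le_rfl, h1.trans h2⟩, ⟨h1.trans h2, le_rfl⟩, ⟨h1, h2⟩]

theorem log_two_pow_add {i k : ℕ} (hk : k < i) : Nat.log 2 (2 ^ i + k) = i := by
  rw [Nat.log_eq_iff (Or.inr ⟨one_lt_two, by positivity⟩)]
  have := Nat.lt_two_pow_self (n := i)
  rw [pow_succ]
  omega

theorem profile_run (α t β : ℝ) {i k : ℕ} (hk : k < i) :
    profile α t β (2 ^ i + k) = if Even i then α else β := by
  have h : IsRun (2 ^ i + k) := by
    rw [IsRun, log_two_pow_add hk]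
    omega
  rw [profile, if_pos h, log_two_pow_add hk]

theorem frequently_profile_eq_left (α t β : ℝ) {l : ℕ} (hl : 0 < l) (n : ℕ) :
    ∃ᶠ m in atTop, ∀ i < n, profile α t β ((m + i) / l) = α := by
  rw [frequently_atTop]
  intro M
  have h2 := Nat.lt_two_pow_self (n := 2 * (n + M))
  -- Start of an even run of 2 (n + M) blocks, far enough out and longer than n digits.
  refine ⟨l * 2 ^ (2 * (n + M)), ?_, fun i hi => ?_⟩
  · nlinarith
  · have := Nat.div_le_self i l
    rw [Nat.mul_add_div hl, profile_run _ _ _ (by omega), if_pos (by simp)]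

theorem frequently_profile_eq_right (α t β : ℝ) {l : ℕ} (hl : 0 < l) (n : ℕ) :
    ∃ᶠ m in atTop, ∀ i < n, profile α t β ((m + i) / l) = β := by
  rw [frequently_atTop]
  intro M
  have h2 := Nat.lt_two_pow_self (n := 2 * (n + M) + 1)
  refine ⟨l * 2 ^ (2 * (n + M) + 1), ?_, fun i hi => ?_⟩
  · nlinarith
  · have := Nat.div_le_self i l
    rw [Nat.mul_add_div hl, profile_run _ _ _ (by omega), if_neg (by simp)]

/-- A run index below j is determined by its dyadic level and its offset in the run, each at most
log₂ j. -/
theorem le_count_not_isRun (j : ℕ) :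
    j ≤ Nat.count (fun i => ¬ IsRun i) j + (Nat.log 2 j + 1) ^ 2 := by
  have h : ((Finset.range j).filter IsRun).card ≤ (Nat.log 2 j + 1) ^ 2 := by
    have hc : (Finset.range (Nat.log 2 j + 1) ×ˢ Finset.range (Nat.log 2 j + 1)).card =
        (Nat.log 2 j + 1) ^ 2 := by
      rw [Finset.card_product, Finset.card_range, sq]
    rw [← hc]
    refine Finset.card_le_card_of_injOn (fun i => (Nat.log 2 i, i - 2 ^ Nat.log 2 i)) ?_ ?_
    · intro i hi
      obtain ⟨h1, h2⟩ := Finset.mem_filter.1 (Finset.mem_coe.1 hi)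
      have h3 : Nat.log 2 i ≤ Nat.log 2 j := Nat.log_mono_right (Finset.mem_range.1 h1).le
      simp only [Finset.coe_product, Finset.coe_range, mem_prod, mem_Iio]
      constructor <;> omega
    · intro i hi i' hi' h
      obtain ⟨_, h1⟩ := Finset.mem_filter.1 (Finset.mem_coe.1 hi)
      obtain ⟨_, h2⟩ := Finset.mem_filter.1 (Finset.mem_coe.1 hi')
      have pos : ∀ i, IsRun i → 2 ^ Nat.log 2 i ≤ i := fun i hi => by
        refine Nat.pow_log_le_self 2 ?_
        rintro rfl
        simp [IsRun] at hi
      have p1 := pos i h1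
      have p2 := pos i' h2
      obtain ⟨e1, e2⟩ := Prod.mk.inj h
      rw [← e1] at e2 p2
      omega
  have h2 := Finset.card_filter_add_card_filter_not (s := Finset.range j) IsRun
  rw [Finset.card_range] at h2
  rw [Nat.count_eq_card_filter_range]
  omega

/-- The runs have density zero. -/
theorem exists_mul_le_count_not_isRun {r s : ℝ} (h0 : 0 < r) (hrs : r < s) :
    ∃ K : ℝ, ∀ j : ℕ, r * (j + 2) ≤ s * Nat.count (fun i => ¬ IsRun i) j + K := by
  have hlim : Tendsto (fun L : ℕ => ((L + 1 : ℕ) : ℝ) ^ 2 / 2 ^ (L + 1)) atTop (𝓝 0) :=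
    (tendsto_add_atTop_iff_nat (f := fun L : ℕ => (L : ℝ) ^ 2 / 2 ^ L) 1).2
      (tendsto_pow_const_div_const_pow_of_one_lt 2 one_lt_two)
  have hlog : Tendsto (Nat.log 2) atTop atTop :=
    tendsto_atTop_atTop.2 fun b => ⟨2 ^ b, fun a h => by
      simpa using Nat.log_mono_right (b := 2) h⟩
  -- The 2 in the denominator compensates for 2 ^ (L + 1) ≤ 2 j, where L = log₂ j.
  have hε : 0 < (s - r) / (2 * s) := div_pos (sub_pos.2 hrs) (by linarith)
  obtain ⟨J, hJ⟩ := eventually_atTop.1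
    (((hlim.comp hlog).eventually (gt_mem_nhds hε)).and (eventually_gt_atTop 0))
  refine ⟨r * (J + 2), fun j => ?_⟩
  rcases lt_or_ge j J with hj | hj
  · have h1 : (j : ℝ) ≤ J := by exact_mod_cast hj.le
    have h2 : 0 ≤ s * (Nat.count (fun i => ¬ IsRun i) j : ℝ) :=
      mul_nonneg (by linarith) (Nat.cast_nonneg _)
    nlinarith
  · obtain ⟨h1, h2⟩ := hJ j hj
    have h3 : ((2 : ℝ) ^ Nat.log 2 j) ≤ j := by exact_mod_cast Nat.pow_log_le_self 2 h2.ne'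
    have h4 : (j : ℝ) ≤ Nat.count (fun i => ¬ IsRun i) j + ((Nat.log 2 j + 1 : ℕ) : ℝ) ^ 2 := by
      exact_mod_cast le_count_not_isRun j
    simp only [Function.comp] at h1
    rw [div_lt_iff₀ (by positivity), pow_succ (2 : ℝ)] at h1
    have h5 : s * ((Nat.log 2 j + 1 : ℕ) : ℝ) ^ 2 ≤ (s - r) * j := by
      have hs : 0 < s := by linarith
      calc s * ((Nat.log 2 j + 1 : ℕ) : ℝ) ^ 2
          ≤ s * ((s - r) / (2 * s) * (2 ^ Nat.log 2 j * 2)) := by gcongr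
        _ = (s - r) * 2 ^ Nat.log 2 j := by field_simp
        _ ≤ (s - r) * j := mul_le_mul_of_nonneg_left h3 (by linarith)
    have h6 : 0 ≤ r * J := by positivity
    nlinarith

theorem infinite_not_isRun : {j | ¬ IsRun j}.Infinite := by
  rw [← Nat.frequently_atTop_iff_infinite, frequently_atTop]
  intro M
  -- The first index after a run.
  refine ⟨2 ^ (M + 1) + (M + 1), ?_, ?_⟩
  · have := Nat.lt_two_pow_self (n := M + 1)
    omega
  · have h : Nat.log 2 (2 ^ (M + 1) + (M + 1)) = M + 1 := by
      rw [Nat.log_eq_iff (Or.inr ⟨one_lt_two, by positivity⟩)]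
      have := Nat.lt_two_pow_self (n := M + 1)
      rw [pow_succ 2 (M + 1)]
      omega
    rw [IsRun, h]
    omega

/-! ### Sequences with prescribed block sums -/

/-- The prescribed sum of the first `j` blocks of length `l`, for a profile `u` of block means. -/
noncomputable def blockTarget (l : ℕ) (u : ℕ → ℝ) (j : ℕ) : ℕ :=
  ⌊l * ∑ i ∈ Finset.range j, u i⌋₊

/-- The prescribed sum of the block with index `j`. -/
noncomputable def blockSize (l : ℕ) (u : ℕ → ℝ) (j : ℕ) : ℕ :=
  blockTarget l u (j + 1) - blockTarget l u j

theorem mul_sum_range_nonneg (l : ℕ) {u : ℕ → ℝ} (hu : ∀ i, u i ∈ Icc (0 : ℝ) 1) (j : ℕ) :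
    0 ≤ l * ∑ i ∈ Finset.range j, u i :=
  mul_nonneg l.cast_nonneg (Finset.sum_nonneg fun i _ => (hu i).1)

theorem blockTarget_succ (l : ℕ) {u : ℕ → ℝ} (hu : ∀ i, u i ∈ Icc (0 : ℝ) 1) (j : ℕ) :
    blockTarget l u (j + 1) = blockTarget l u j + blockSize l u j := by
  refine (Nat.add_sub_of_le (Nat.floor_le_floor ?_)).symm
  rw [Finset.sum_range_succ]
  have := (hu j).1
  gcongr
  linarith

theorem abs_blockSize_sub_lt (l : ℕ) {u : ℕ → ℝ} (hu : ∀ i, u i ∈ Icc (0 : ℝ) 1) (j : ℕ) :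
    |(blockSize l u j : ℝ) - l * u j| < 1 := by
  have h : (blockTarget l u (j + 1) : ℝ) = blockTarget l u j + blockSize l u j := by
    exact_mod_cast blockTarget_succ l hu j
  have a1 := Nat.floor_le (mul_sum_range_nonneg l hu j)
  have a2 := Nat.lt_floor_add_one (l * ∑ i ∈ Finset.range j, u i)
  have b1 := Nat.floor_le (mul_sum_range_nonneg l hu (j + 1))
  have b2 := Nat.lt_floor_add_one (l * ∑ i ∈ Finset.range (j + 1), u i)
  rw [← blockTarget] at a1 a2 b1 b2
  rw [Finset.sum_range_succ, mul_add] at b1 b2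
  rw [abs_lt]
  constructor <;> linarith

theorem blockSize_le (l : ℕ) {u : ℕ → ℝ} (hu : ∀ i, u i ∈ Icc (0 : ℝ) 1) (j : ℕ) :
    blockSize l u j ≤ l := by
  have h1 := (abs_lt.1 (abs_blockSize_sub_lt l hu j)).2
  have h2 : l * u j ≤ l := mul_le_of_le_one_right l.cast_nonneg (hu j).2
  have h3 : (blockSize l u j : ℝ) < l + 1 := by linarith
  exact Nat.le_of_lt_succ (by exact_mod_cast h3)

/-- The `0`-`1` sequence whose block with index `j`, of length `l`, is the indicator of `s j`. -/
def blockDigit (l : ℕ) (s : ℕ → Finset ℕ) (n : ℕ) : ℕ :=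
  if n % l ∈ s (n / l) then 1 else 0

theorem blockDigit_lt (l : ℕ) (s : ℕ → Finset ℕ) (n : ℕ) : blockDigit l s n < 2 := by
  unfold blockDigit
  split_ifs <;> norm_num

theorem blockDigit_mul_add {l : ℕ} (s : ℕ → Finset ℕ) (j : ℕ) {k : ℕ} (hk : k < l) :
    blockDigit l s (j * l + k) = if k ∈ s j then 1 else 0 := by
  have hl : 0 < l := by omega
  rw [blockDigit, mul_comm, Nat.mul_add_mod, Nat.mod_eq_of_lt hk, Nat.mul_add_div hl,
    Nat.div_eq_of_lt hk, add_zero]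

theorem sum_blockDigit_block {l : ℕ} {s : ℕ → Finset ℕ} {j : ℕ} (hs : s j ⊆ Finset.range l) :
    ∑ k ∈ Finset.range l, blockDigit l s (j * l + k) = (s j).card := by
  rw [Finset.sum_congr rfl fun k hk => blockDigit_mul_add s j (Finset.mem_range.1 hk),
    Finset.sum_boole, Finset.filter_mem_eq_inter, Finset.inter_eq_right.2 hs, Nat.cast_id]

theorem sum_blockDigit {l : ℕ} {u : ℕ → ℝ} (hu : ∀ i, u i ∈ Icc (0 : ℝ) 1) {s : ℕ → Finset ℕ}
    (hs : ∀ j, s j ∈ Finset.powersetCard (blockSize l u j) (Finset.range l)) (j : ℕ) :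
    ∑ i ∈ Finset.range (j * l), blockDigit l s i = blockTarget l u j := by
  induction j with
  | zero => simp [blockTarget]
  | succ j ih =>
    obtain ⟨h1, h2⟩ := Finset.mem_powersetCard.1 (hs j)
    rw [add_mul, one_mul, Finset.sum_range_add, ih, sum_blockDigit_block h1, h2,
      blockTarget_succ l hu]

theorem sum_profile_blocks {l : ℕ} (u : ℕ → ℝ) (j : ℕ) :
    ∑ i ∈ Finset.range (j * l), u (i / l) = l * ∑ i ∈ Finset.range j, u i := by
  induction j with
  | zero => simp
  | succ j ih =>
    rw [add_mul, one_mul, Finset.sum_range_add, ih, Finset.sum_range_succ, mul_add]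
    congr 1
    have : ∀ k ∈ Finset.range l, u ((j * l + k) / l) = u j := fun k hk => by
      have hk' := Finset.mem_range.1 hk
      rw [mul_comm, Nat.mul_add_div (by omega), Nat.div_eq_of_lt hk', add_zero]
    rw [Finset.sum_congr rfl this]
    simp

/-- At block ends the two sums differ by less than 1, the error of the floor. Both are monotone in
between, and the profile sum grows by at most l per block. -/
theorem blockDigit_discrepancy {l : ℕ} (hl : 0 < l) {u : ℕ → ℝ} (hu : ∀ i, u i ∈ Icc (0 : ℝ) 1)
    {s : ℕ → Finset ℕ}
    (hs : ∀ j, s j ∈ Finset.powersetCard (blockSize l u j) (Finset.range l)) (N : ℕ) :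
    |∑ i ∈ Finset.range N, (blockDigit l s i : ℝ) - ∑ i ∈ Finset.range N, u (i / l)| ≤ l + 1 := by
  have hblock : ∀ j, (∑ i ∈ Finset.range (j * l), (blockDigit l s i : ℝ)) = blockTarget l u j :=
    fun j => by exact_mod_cast sum_blockDigit hu hs j
  have hmono : ∀ {a b : ℕ}, a ≤ b → (∑ i ∈ Finset.range a, (blockDigit l s i : ℝ)) ≤
      ∑ i ∈ Finset.range b, (blockDigit l s i : ℝ) := fun h =>
    Finset.sum_le_sum_of_subset_of_nonneg (Finset.range_mono h) fun i _ _ => Nat.cast_nonneg _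
  have hmono' : ∀ {a b : ℕ}, a ≤ b → (∑ i ∈ Finset.range a, u (i / l)) ≤
      ∑ i ∈ Finset.range b, u (i / l) := fun h =>
    Finset.sum_le_sum_of_subset_of_nonneg (Finset.range_mono h) fun i _ _ => (hu _).1
  set j := N / l
  have h1 : j * l ≤ N := Nat.div_mul_le_self N l
  have h2 : N ≤ (j + 1) * l := ((Nat.div_lt_iff_lt_mul hl).1 (Nat.lt_succ_self _)).le
  have a1 := hmono h1
  have a2 := hmono h2
  have c1 := hmono' h1
  have c2 := hmono' h2
  rw [hblock] at a1 a2
  rw [sum_profile_blocks] at c1 c2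
  have d1 := Nat.floor_le (mul_sum_range_nonneg l hu (j + 1))
  have d2 := Nat.lt_floor_add_one (l * ∑ i ∈ Finset.range j, u i)
  rw [← blockTarget] at d1 d2
  have e : l * ∑ i ∈ Finset.range (j + 1), u i ≤ l * ∑ i ∈ Finset.range j, u i + l := by
    rw [Finset.sum_range_succ, mul_add]
    have : l * u j ≤ l := mul_le_of_le_one_right l.cast_nonneg (hu j).2
    linarith
  rw [abs_le]
  constructor <;> linarith

theorem frequently_blockDigit_ne_zero {l : ℕ} {s : ℕ → Finset ℕ}
    (hs : ∀ j, s j ⊆ Finset.range l) (h : ∃ᶠ j in atTop, (s j).Nonempty) (hl : 0 < l) :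
    ∃ᶠ n in atTop, blockDigit l s n ≠ 0 := by
  rw [frequently_atTop] at h ⊢
  intro M
  obtain ⟨j, hj, k, hk⟩ := h M
  refine ⟨j * l + k, by nlinarith, ?_⟩
  rw [blockDigit_mul_add s j (Finset.mem_range.1 (hs j hk)), if_pos hk]
  exact one_ne_zero

theorem exists_blockDigit_ne {l : ℕ} {s s' : ℕ → Finset ℕ} {j : ℕ} (hs : s j ⊆ Finset.range l)
    (hs' : s' j ⊆ Finset.range l) (h : s j ≠ s' j) :
    ∃ n < (j + 1) * l, blockDigit l s n ≠ blockDigit l s' n := by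
  by_contra! hc
  refine h (Finset.ext fun k => ?_)
  rcases lt_or_ge k l with hk | hk
  · have := hc (j * l + k) (by rw [add_mul]; omega)
    rw [blockDigit_mul_add s j hk, blockDigit_mul_add s' j hk] at this
    by_cases h1 : k ∈ s j <;> by_cases h2 : k ∈ s' j <;> simp_all
  · have h1 : k ∉ s j := fun h => by have := Finset.mem_range.1 (hs h); omega
    have h2 : k ∉ s' j := fun h => by have := Finset.mem_range.1 (hs' h); omega
    simp [h1, h2]


/-! ### Lower bound for the dimension -/

theorem blockDigit_mem_banachSet {α t β : ℝ} (h0 : 0 ≤ α) (h1 : α ≤ t) (h2 : t ≤ β) (h3 : β ≤ 1)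
    {l : ℕ} (hl : 0 < l) {s : ℕ → Finset ℕ}
    (hs : ∀ j, s j ∈ Finset.powersetCard (blockSize l (profile α t β) j) (Finset.range l))
    (hne : ∃ᶠ j in atTop, (s j).Nonempty) :
    ∑' n, (blockDigit l s n : ℝ) / (2 : ℝ) ^ (n + 1) ∈ banachSet 2 α β := by
  have hu : ∀ i, profile α t β i ∈ Icc (0 : ℝ) 1 := fun i =>
    Icc_subset_Icc h0 h3 (profile_mem h1 h2 i)
  have hlt := blockDigit_lt l s
  have hx : ∑' n, (blockDigit l s n : ℝ) / (2 : ℝ) ^ (n + 1) ∈ Icc (0 : ℝ) 1 := by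
    exact_mod_cast expansion_mem le_rfl hlt
  have hdigit := eq_digit le_rfl hlt (summable_expansion le_rfl hlt).hasSum
    (Or.inr (frequently_blockDigit_ne_zero (fun j => (Finset.mem_powersetCard.1 (hs j)).1) hne hl))
  rw [Nat.cast_ofNat] at hdigit
  refine mem_banachSet_of_discrepancy (τ := fun i => profile α t β (i / l)) (C := l + 1) hx
    (fun i => profile_mem h1 h2 _) (fun N => ?_) (frequently_profile_eq_left α t β hl)
    (frequently_profile_eq_right α t β hl)
  simp_rw [← hdigit]
  exact blockDigit_discrepancy hl hu hs N

/-- Points of `[0, 1]` whose expansions to base `P` differ are separated by their images under the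
block coding. -/
theorem abs_sub_le_mul_blockDigit {P l : ℕ} (hP : 2 ≤ P) (hl : 0 < l) {r q K : ℝ} (hr : 0 < r)
    (hPq : (2 : ℝ) ^ (l * q) ≤ P)
    (hK : ∀ j : ℕ, r * (j + 2) ≤ q * Nat.count (fun i => ¬ IsRun i) j + K)
    {u : ℕ → ℝ} {φ : ℕ → ℕ → Finset ℕ}
    (hφ : ∀ j a, φ j a ∈ Finset.powersetCard (blockSize l u j) (Finset.range l))
    (hinj : ∀ j, ¬ IsRun j → InjOn (φ j) (Iio P)) {x y : ℝ} (hx : x ∈ Icc (0 : ℝ) 1)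
    (hy : y ∈ Icc (0 : ℝ) 1) :
    |x - y| ≤ 2 ^ (l * K) *
      |∑' n, (blockDigit l (fun j => φ j (digit P x (Nat.count (fun i => ¬ IsRun i) j))) n : ℝ) /
          (2 : ℝ) ^ (n + 1) -
        ∑' n, (blockDigit l (fun j => φ j (digit P y (Nat.count (fun i => ¬ IsRun i) j))) n : ℝ) /
          (2 : ℝ) ^ (n + 1)| ^ r := by
  classical
  set c := Nat.count fun i => ¬ IsRun i with hc
  rcases eq_or_ne x y with rfl | hxy
  · rw [sub_self, abs_zero]
    positivity
  have hex : ∃ k, digit P x k ≠ digit P y k := by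
    by_contra! h
    refine hxy ((hasSum_digit hP hx).unique ?_)
    simp_rw [h]
    exact hasSum_digit hP hy
  -- The first differing base-P digit has index k; the block j that encodes it is the k-th one
  -- outside the runs.
  set k := Nat.find hex
  set j := Nat.nth (fun i => ¬ IsRun i) k
  have hj : ¬ IsRun j := Nat.nth_mem_of_infinite infinite_not_isRun k
  have hcj : c j = k := Nat.count_nth_of_infinite infinite_not_isRun k
  have hclose := abs_sub_le_of_digit_eq hP hx hy (n := c j) fun i hi =>
    not_not.1 (Nat.find_min hex (hi.trans_eq hcj))
  have hsub : ∀ j a, φ j a ⊆ Finset.range l := fun j a => (Finset.mem_powersetCard.1 (hφ j a)).1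
  obtain ⟨n, hn, hne⟩ := exists_blockDigit_ne (s := fun j => φ j (digit P x (c j)))
    (s' := fun j => φ j (digit P y (c j))) (hsub j _) (hsub j _) fun h => by
      have := hinj j hj (digit_lt hP x _) (digit_lt hP y _) h
      rw [hcj] at this
      exact Nat.find_spec hex this
  -- Block j + 1 serves as the window of equal sums: its sum is prescribed by the profile, whatever
  -- the encoded point. It ends at (j + 2) l, whence the j + 2 in `hK`.
  have hsep := le_abs_sub_of_window_eq (blockDigit_lt l _) (blockDigit_lt l _) hne hn hl (by
    rw [sum_blockDigit_block (s := fun j => φ j (digit P x (c j))) (hsub _ _),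
      sum_blockDigit_block (s := fun j => φ j (digit P y (c j))) (hsub _ _),
      (Finset.mem_powersetCard.1 (hφ _ _)).2, (Finset.mem_powersetCard.1 (hφ _ _)).2])
  refine hclose.trans (le_trans ?_ (mul_le_mul_of_nonneg_left
    (Real.rpow_le_rpow (by positivity) hsep hr.le) (by positivity)))
  have hl' : (0 : ℝ) < l := by exact_mod_cast hl
  calc ((P : ℝ) ^ c j)⁻¹ ≤ (((2 : ℝ) ^ (l * q)) ^ c j)⁻¹ :=
        inv_anti₀ (by positivity) (pow_le_pow_left₀ (by positivity) hPq _)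
    _ = (2 : ℝ) ^ (-(l * q * c j)) := by
        rw [← Real.rpow_mul_natCast two_pos.le, Real.rpow_neg two_pos.le]
    _ ≤ (2 : ℝ) ^ (l * K + -(((j + 1) * l + l : ℕ) : ℝ) * r) := by
        refine Real.rpow_le_rpow_of_exponent_le one_le_two ?_
        have := mul_le_mul_of_nonneg_left (hK j) hl'.le
        push_cast
        linarith
    _ = 2 ^ (l * K) * (((2 : ℝ) ^ ((j + 1) * l + l))⁻¹) ^ r := by
        rw [Real.rpow_add two_pos, Real.rpow_mul two_pos.le (-_), Real.rpow_neg two_pos.le,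
          Real.rpow_natCast]

/-- The code of a block. The default value `Finset.range k` keeps the prescribed size on run blocks
too, where there may be fewer than P choices. -/
theorem exists_injOn_powersetCard {P l k : ℕ} (hk : k ≤ l) :
    ∃ φ : ℕ → Finset ℕ, (∀ a, φ a ∈ Finset.powersetCard k (Finset.range l)) ∧
      (P ≤ l.choose k → InjOn φ (Iio P)) := by
  have hcard : (Finset.powersetCard k (Finset.range l)).card = l.choose k := by simp
  have e := (Finset.powersetCard k (Finset.range l)).equivFinOfCardEq hcard
  refine ⟨fun a => if h : a < l.choose k then (e.symm ⟨a, h⟩ : Finset ℕ) else Finset.range k,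
    fun a => ?_, fun hP a ha b hb hab => ?_⟩
  · simp only
    split_ifs with h
    · exact (e.symm ⟨a, h⟩).2
    · simp [Finset.mem_powersetCard, hk]
  · have ha' : a < l.choose k := lt_of_lt_of_le ha hP
    have hb' : b < l.choose k := lt_of_lt_of_le hb hP
    simp only [dif_pos ha', dif_pos hb'] at hab
    simpa using e.symm.injective (Subtype.ext hab)

theorem ofReal_le_dimH_banachSet {α t β r : ℝ} (h0 : 0 ≤ α) (h1 : α ≤ t) (h2 : t ≤ β) (h3 : β ≤ 1)
    (hr : 0 < r) (hrt : r < h₂ t) : ENNReal.ofReal r ≤ dimH (banachSet 2 α β) := by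
  obtain ⟨q, hrq, hqt⟩ := exists_between hrt
  obtain ⟨l, hchoose, hl⟩ :=
    ((eventually_rpow_le_choose hqt).and (eventually_gt_atTop 0)).exists
  obtain ⟨K, hK⟩ := exists_mul_le_count_not_isRun hr hrq
  have hl' : (0 : ℝ) < l := by exact_mod_cast hl
  -- Binomial coefficients are integers, so rounding up still leaves P at most the number of
  -- fillings of a block outside the runs.
  set P := ⌈(2 : ℝ) ^ (l * q)⌉₊
  have hPq : (2 : ℝ) ^ (l * q) ≤ P := Nat.le_ceil _
  have hP : 2 ≤ P := by
    have : (1 : ℝ) < P :=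
      (Real.one_lt_rpow one_lt_two (mul_pos hl' (hr.trans hrq))).trans_le hPq
    exact_mod_cast this
  have hu : ∀ i, profile α t β i ∈ Icc (0 : ℝ) 1 := fun i =>
    Icc_subset_Icc h0 h3 (profile_mem h1 h2 i)
  have hPc : ∀ j, ¬ IsRun j → P ≤ l.choose (blockSize l (profile α t β) j) := fun j hj => by
    refine Nat.ceil_le.2 (hchoose _ (blockSize_le l hu j) ?_)
    have := abs_blockSize_sub_lt l hu j
    rwa [show profile α t β j = t from if_neg hj] at this
  choose φ hφ hinj using fun j => exists_injOn_powersetCard (P := P) (blockSize_le l hu j)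
  refine (le_dimH_image_of_expanding hr fun x hx y hy => abs_sub_le_mul_blockDigit hP hl hr hPq hK
    hφ (fun j hj => hinj j (hPc j hj)) hx hy).trans (dimH_mono ?_)
  rintro _ ⟨x, -, rfl⟩
  refine blockDigit_mem_banachSet h0 h1 h2 h3 hl (fun j => hφ j _) ?_
  -- Blocks outside the runs are nonempty, since size 0 would leave a single filling, fewer than P.
  -- Hence the expansion is non-terminating and its terms are the true digits.
  refine (Nat.frequently_atTop_iff_infinite.2 infinite_not_isRun).mono fun j hj => ?_
  rw [← Finset.card_pos, (Finset.mem_powersetCard.1 (hφ j _)).2, Nat.pos_iff_ne_zero]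
  intro h
  have := hPc j hj
  rw [h, Nat.choose_zero_right] at this
  omega

theorem le_dimH_banachSet {α t β : ℝ} (h0 : 0 ≤ α) (h1 : α ≤ t) (h2 : t ≤ β) (h3 : β ≤ 1) :
    ENNReal.ofReal (h₂ t) ≤ dimH (banachSet 2 α β) := by
  rcases le_or_gt (h₂ t) 0 with h | h
  · simp [ENNReal.ofReal_of_nonpos h]
  have hlim : Tendsto ENNReal.ofReal (𝓝[<] h₂ t) (𝓝 (ENNReal.ofReal (h₂ t))) :=
    ENNReal.continuous_ofReal.continuousAt.tendsto.mono_left nhdsWithin_le_nhds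
  refine le_of_tendsto hlim ?_
  filter_upwards [self_mem_nhdsWithin, nhdsWithin_le_nhds (lt_mem_nhds h)] with r hr hr0
  exact ofReal_le_dimH_banachSet h0 h1 h2 h3 hr0 hr

theorem dimH_banachSet {α β : ℝ} (h0 : 0 ≤ α) (hαβ : α ≤ β) (h1 : β ≤ 1) :
    dimH (banachSet 2 α β) = ⨆ t ∈ Icc α β, ENNReal.ofReal (h₂ t) :=
  le_antisymm (dimH_banachSet_le h0 hαβ h1)
    (iSup₂_le fun _ ht => le_dimH_banachSet h0 ht.1 ht.2 h1)

end MovingDigitMean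

theorem corollary1p3 :
    (∀ α : ℝ, 0 ≤ α → α ≤ 1 → MovingDigitMean.IsEntropy 2 α (MovingDigitMean.h₂ α)) ∧
    (∀ α β : ℝ, 0 ≤ α → α ≤ β → β ≤ 1 →
      dimH (MovingDigitMean.banachSet 2 α β) =
        ⨆ t ∈ Set.Icc α β, ENNReal.ofReal (MovingDigitMean.h₂ t)) ∧
    (∀ α : ℝ, 0 ≤ α → α ≤ 1 →
      dimH (MovingDigitMean.banachSet 2 α α) = ENNReal.ofReal (MovingDigitMean.h₂ α)) := by
  refine ⟨fun α h0 h1 => MovingDigitMean.isEntropy_h₂ h0 h1,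
    fun α β h0 h h1 => MovingDigitMean.dimH_banachSet h0 h h1, fun α h0 h1 => ?_⟩
  rw [MovingDigitMean.dimH_banachSet h0 le_rfl h1]
  simp
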